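/- **Eynard–Mehta theorem for the two-matrix model.** Let $n\ge 1$, let $V,W$ be real polynomials of even degree with positive leading coefficients, and let $\tau\in\mathbb R\setminus\{0\}$. Assume that the partition function $$Z_n=\int_{\mathcal H_n}\int_{\mathcal H_n} e^{\operatorname{Tr}(-V(M_1)-W(M_2)+\tau M_1M_2)}\,dM_1\,dM_2$$ converges, where $\mathcal H_n$ is the space of Hermitian $n\times n$ matrices with Lebesgue measure. Then there are unique sequences of monic polynomials $p_i(x)=x^i+O(x^{i-1})$, $q_j(y)=y^j+O(y^{j-1})$ $(i,j\ge 0)$ such that $$\int_{\mathbb R}\int_{\mathbb R} p_i(x)q_j(y)e^{-V(x)-W(y)+\tau xy}\,dx\,dy=0\qquad (i\ne j),$$ and the numbers $h_i^2:=\iint p_i(x)q_i(y)e^{-V(x)-W(y)+\tau xy}\,dx\,dy$ (a single symbol) are all nonzero. Put $P_i(y)=\int_{\mathbb R} p_i(x)e^{-V(x)-W(y)+\tau xy}\,dx$, $Q_j(x)=\int_{\mathbb R} q_j(y)e^{-V(x)-W(y)+\tau xy}\,dy$, and define the Eynard–Mehta kernels $$K_{1,1}(x_1,x_2)=\sum_{i=0}^{n-1}\frac{p_i(x_1)Q_i(x_2)}{h_i^2},\qquad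 K_{1,2}(x,y)=\sum_{i=0}^{n-1}\frac{p_i(x)q_i(y)}{h_i^2},$$ $$K_{2,1}(y,x)=\sum_{i=0}^{n-1}\frac{P_i(y)Q_i(x)}{h_i^2}-e^{-V(x)-W(y)+\tau xy},\qquad K_{2,2}(y_1,y_2)=\sum_{i=0}^{n-1}\frac{P_i(y_1)q_i(y_2)}{h_i^2}.$$ For $\lambda,\mu\in\mathbb R^n$ let $$\rho(\lambda,\mu)=\prod_{i=1}^n\bigl(e^{-V(\lambda_i)}e^{-W(\mu_i)}\bigr)\,\Delta(\lambda)\Delta(\mu)\det\bigl(e^{\tau\lambda_i\mu_j}\bigr)_{i,j=1}^n,\qquad \Delta(x)=\prod_{1\le i<j\le n}(x_j-x_i),$$ be the unnormalized joint eigenvalue density of $(M_1,M_2)$. Then $\rho$ is integrable and $\widetilde Z_n:=\int_{\mathbb R^{n}\times\mathbb R^n}\rho\,d\lambda\,d\mu\neq 0$. For $0\le I,J\le n$ and real numbers $\lambda_1,\dots,\lambda_I,\mu_1,\dots,\mu_J$ define the correlation function $$R_{I,J}(\lambda_1,\dots,\lambda_I;\mu_1,\dots,\mu_J)=\frac{n!}{(n-I)!}\,\frac{n!}{(n-J)!}\,\frac1{\widetilde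 Z_n}\int_{\mathbb R^{n-I}\times\mathbb R^{n-J}}\rho(\lambda,\mu)\prod_{i=I+1}^n d\lambda_i\prod_{j=J+1}^n d\mu_j .$$ Then for all such $I,J$ and all real $\lambda_1,\dots,\lambda_I,\mu_1,\dots,\mu_J$ this integral converges absolutely, and $$R_{I,J}(\lambda_1,\dots,\lambda_I;\mu_1,\dots,\mu_J)=\det\begin{pmatrix}\bigl(K_{1,1}(\lambda_i,\lambda_j)\bigr)_{i,j=1}^{I} & \bigl(K_{1,2}(\lambda_i,\mu_j)\bigr)_{1\le i\le I,\,1\le j\le J}\\[4pt] \bigl(K_{2,1}(\mu_i,\lambda_j)\bigr)_{1\le i\le J,\,1\le j\le I} & \bigl(K_{2,2}(\mu_i,\mu_j)\bigr)_{i,j=1}^{J}\end{pmatrix}.$$ -/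

import Mathlib

open MeasureTheory Polynomial

namespace TwoMatrix

noncomputable section

/-! ### The two-matrix model on pairs of Hermitian matrices -/

/-- Real coordinates on the space of Hermitian `n × n` matrices: the (real) diagonal entries and
the (complex) entries strictly above the diagonal. The measure `volume` on this type is the
Lebesgue measure `dM` on Hermitian matrices. -/
abbrev HermCoord (n : ℕ) : Type :=
  (Fin n → ℝ) × ({e : Fin n × Fin n // e.1 < e.2} → ℂ)

/-- The Hermitian matrix with the given coordinates. -/
def hermMatrix {n : ℕ} (c : HermCoord n) : Matrix (Fin n) (Fin n) ℂ :=
  Matrix.of fun i j =>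
    if h : i < j then c.2 ⟨(i, j), h⟩
    else if h' : j < i then star (c.2 ⟨(j, i), h'⟩)
    else (c.1 i : ℂ)

theorem hermMatrix_isHermitian {n : ℕ} (c : HermCoord n) : (hermMatrix c).IsHermitian := by
  ext i j
  rcases lt_trichotomy i j with h | h | h
  · simp [hermMatrix, h, h.not_gt]
  · subst h
    simp [hermMatrix]
  · simp [hermMatrix, h, h.not_gt]

/-- The unnormalized density `exp (Tr (-V(M₁) - W(M₂) + τ M₁ M₂))` of the two-matrix model
(the trace is real). -/
def matrixDensity (V W : ℝ[X]) (τ : ℝ) {n : ℕ} (c d : HermCoord n) : ℝ :=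
  Real.exp (Matrix.trace
    (-(aeval (hermMatrix c) V) - aeval (hermMatrix d) W
      + τ • (hermMatrix c * hermMatrix d))).re

/-! ### Biorthogonal polynomials and transformed functions -/

/-- The weight `exp (-V(x) - W(y) + τ x y)`. -/
def weight (V W : ℝ[X]) (τ x y : ℝ) : ℝ :=
  Real.exp (-V.eval x - W.eval y + τ * x * y)

/-- The pairing `∬ f(x) g(y) exp (-V(x) - W(y) + τ x y) dx dy` of two polynomials. -/
def pairing (V W : ℝ[X]) (τ : ℝ) (f g : ℝ[X]) : ℝ :=
  ∫ z : ℝ × ℝ, f.eval z.1 * g.eval z.2 * weight V W τ z.1 z.2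

/-- `p` and `q` are the two sequences of monic biorthogonal polynomials. -/
structure IsBiorthogonal (V W : ℝ[X]) (τ : ℝ) (p q : ℕ → ℝ[X]) : Prop where
  monic_left : ∀ i, (p i).Monic
  natDegree_left : ∀ i, (p i).natDegree = i
  monic_right : ∀ j, (q j).Monic
  natDegree_right : ∀ j, (q j).natDegree = j
  orthogonal : ∀ i j, i ≠ j → pairing V W τ (p i) (q j) = 0

/-- The constant usually written `h_i ^ 2`. -/
def hSq (V W : ℝ[X]) (τ : ℝ) (p q : ℕ → ℝ[X]) (i : ℕ) : ℝ :=
  pairing V W τ (p i) (q i)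

/-- The transformed function `P_i(y) = ∫ p_i(x) exp (-V(x) - W(y) + τ x y) dx`. -/
def transP (V W : ℝ[X]) (τ : ℝ) (p : ℕ → ℝ[X]) (i : ℕ) (y : ℝ) : ℝ :=
  ∫ x : ℝ, (p i).eval x * weight V W τ x y

/-- The transformed function `Q_j(x) = ∫ q_j(y) exp (-V(x) - W(y) + τ x y) dy`. -/
def transQ (V W : ℝ[X]) (τ : ℝ) (q : ℕ → ℝ[X]) (j : ℕ) (x : ℝ) : ℝ :=
  ∫ y : ℝ, (q j).eval y * weight V W τ x y

/-! ### The four Eynard-Mehta kernels -/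

def K11 (V W : ℝ[X]) (τ : ℝ) (p q : ℕ → ℝ[X]) (n : ℕ) (x₁ x₂ : ℝ) : ℝ :=
  ∑ i ∈ Finset.range n, 1 / hSq V W τ p q i * (p i).eval x₁ * transQ V W τ q i x₂

def K12 (V W : ℝ[X]) (τ : ℝ) (p q : ℕ → ℝ[X]) (n : ℕ) (x y : ℝ) : ℝ :=
  ∑ i ∈ Finset.range n, 1 / hSq V W τ p q i * (p i).eval x * (q i).eval y

def K21 (V W : ℝ[X]) (τ : ℝ) (p q : ℕ → ℝ[X]) (n : ℕ) (y x : ℝ) : ℝ :=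
  (∑ i ∈ Finset.range n, 1 / hSq V W τ p q i * transP V W τ p i y * transQ V W τ q i x)
    - weight V W τ x y

def K22 (V W : ℝ[X]) (τ : ℝ) (p q : ℕ → ℝ[X]) (n : ℕ) (y₁ y₂ : ℝ) : ℝ :=
  ∑ i ∈ Finset.range n, 1 / hSq V W τ p q i * transP V W τ p i y₁ * (q i).eval y₂

/-- The matrix of size `I + J` built from the four kernels at the points
`l 0, …, l (I-1)` and `m 0, …, m (J-1)`. -/
def kernelMatrix (V W : ℝ[X]) (τ : ℝ) (p q : ℕ → ℝ[X]) (n : ℕ) {I J : ℕ}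
    (l : Fin I → ℝ) (m : Fin J → ℝ) : Matrix (Fin I ⊕ Fin J) (Fin I ⊕ Fin J) ℝ :=
  Matrix.fromBlocks
    (Matrix.of fun i j => K11 V W τ p q n (l i) (l j))
    (Matrix.of fun i j => K12 V W τ p q n (l i) (m j))
    (Matrix.of fun i j => K21 V W τ p q n (m i) (l j))
    (Matrix.of fun i j => K22 V W τ p q n (m i) (m j))

/-! ### Eigenvalue density and correlation functions -/

/-- The Vandermonde product `∏_{i<j} (x_j - x_i)`. -/
def vdm {n : ℕ} (x : Fin n → ℝ) : ℝ :=
  ∏ i, ∏ j ∈ Finset.Ioi i, (x j - x i)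

/-- The unnormalized joint density of the eigenvalues of the two matrices. -/
def eigDensity (V W : ℝ[X]) (τ : ℝ) {n : ℕ} (l m : Fin n → ℝ) : ℝ :=
  (∏ i, Real.exp (-V.eval (l i)) * Real.exp (-W.eval (m i))) * vdm l * vdm m *
    (Matrix.of fun i j : Fin n => Real.exp (τ * l i * m j)).det

/-- The normalization constant of the eigenvalue density. -/
def eigPartition (V W : ℝ[X]) (τ : ℝ) (n : ℕ) : ℝ :=
  ∫ z : (Fin n → ℝ) × (Fin n → ℝ), eigDensity V W τ z.1 z.2

/-- The vector of length `n` whose first `I` entries are those of `x` and whose remaining `n - I`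
entries are those of `t`. -/
def fill {I n : ℕ} (x : Fin I → ℝ) (t : Fin (n - I) → ℝ) : Fin n → ℝ :=
  fun k => if h : (k : ℕ) < I then x ⟨k, h⟩ else t ⟨k - I, by omega⟩

/-- The `(I, J)`-point correlation function (for `I, J ≤ n`): all but the first `I` eigenvalues of
the first matrix and the first `J` eigenvalues of the second matrix are integrated out. -/
def corr (V W : ℝ[X]) (τ : ℝ) (n : ℕ) {I J : ℕ} (l : Fin I → ℝ) (m : Fin J → ℝ) : ℝ :=
  ((n.factorial : ℝ) / ((n - I).factorial : ℝ)) * ((n.factorial : ℝ) / ((n - J).factorial : ℝ)) *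
    (1 / eigPartition V W τ n *
      ∫ z : (Fin (n - I) → ℝ) × (Fin (n - J) → ℝ),
        eigDensity V W τ (fill l z.1 : Fin n → ℝ) (fill m z.2))

end

end TwoMatrix

/-!
Convergence of the matrix integral is used only through a pointwise bound
`weight x y ≤ B exp (-ε x²) exp (-ε y²)`. If one of `V`, `W` is constant, or if both are quadratic
with leading coefficients `a`, `a'` and `4 a a' ≤ τ²`, then the density does not decay along the
pairs `(M, κ M)` for some `κ` (up to exchanging the matrices), and averaging over `M ↦ -M` bounds
the integral below by a multiple of the infinite volume of the space of Hermitian matrices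
(`not_integrable_matrixDensity`). In the remaining cases `V` and `W` dominate quadratic
polynomials that outweigh `τ x y` (`exists_gaussianBound`).

The pairing is nondegenerate on polynomials of each bounded degree
(`GaussianBound.exists_pairing_ne_zero`). For `f ≠ 0` the transform
`y ↦ ∫ f(x) exp (-V(x) + τ x y) dx` has at most `deg f` zeros: multiplication of `f` by `X - c` is
differentiation of the transform after multiplication by an exponential, so Rolle's theorem
reduces the count to the case of a polynomial without sign changes, where the transform has no
zero. Hence some nonzero polynomial `g` with `deg g ≤ deg f` has the sign of the transform
everywhere, and the pairing of `f` with `g` is positive. Existence and uniqueness of the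
biorthogonal polynomials and `h_i² ≠ 0` are linear algebra from there.

The four kernels are the blocks of one kernel `K = ∑ φ_i ⊗ ψ_i / h_i² - ω` on two disjoint copies
of the line (`emKernel`). At `n + n` points the matrix of `K` is a product of two block triangular
matrices, up to a rotation, which gives `eigDensity = (∏ h_i²) det K` (`eigDensity_eq_kernelDet`).
Biorthogonality gives `∫ K(a, x) K(x, b) dx = K(a, b)` or `0` for `x` on the first line, according
to the line on which `a` lies, and expanding a bordered determinant shows that integrating out one
of the points on the first line, when `I` of the others lie there, multiplies the remaining
determinant by `n - I` (`integral_kernelDet_insert`). Exchanging the two matrices transposes `K`,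
which handles the second line. The Gaussian bound makes all these determinants integrable
(`integrable_kernelDet_prod`), and iteration gives `(n - I)! (n - J)! (∏ h_i²) det K` for the
integral over all but `I + J` points; the case `I = J = 0` is the normalization constant.
-/

namespace TwoMatrix

noncomputable section

/-! ### From convergence of the matrix integral to a Gaussian bound on the weight -/

theorem hermMatrix_add {n : ℕ} (c d : HermCoord n) :
    hermMatrix (c + d) = hermMatrix c + hermMatrix d := by
  ext i j
  simp only [hermMatrix, Matrix.of_apply, Matrix.add_apply]
  split_ifs <;> simp

theorem hermMatrix_smul {n : ℕ} (r : ℝ) (c : HermCoord n) :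
    hermMatrix (r • c) = r • hermMatrix c := by
  ext i j
  simp only [hermMatrix, Matrix.of_apply, Matrix.smul_apply]
  split_ifs <;> simp

/-- The real trace form `Re Tr (M₁ M₂)` in Hermitian coordinates, as a bilinear form. -/
def traceForm (n : ℕ) : HermCoord n →ₗ[ℝ] HermCoord n →ₗ[ℝ] ℝ :=
  LinearMap.mk₂ ℝ (fun c d => (Matrix.trace (hermMatrix c * hermMatrix d)).re)
    (fun c c' d => by simp [hermMatrix_add, add_mul])
    (fun r c d => by simp [hermMatrix_smul])
    (fun c d d' => by simp [hermMatrix_add, mul_add])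
    (fun r c d => by simp [hermMatrix_smul])

theorem traceForm_apply {n : ℕ} (c d : HermCoord n) :
    traceForm n c d = (Matrix.trace (hermMatrix c * hermMatrix d)).re := rfl

theorem traceForm_comm {n : ℕ} (c d : HermCoord n) : traceForm n c d = traceForm n d c := by
  rw [traceForm_apply, traceForm_apply, Matrix.trace_mul_comm]

open scoped ComplexOrder in
theorem traceForm_self_nonneg {n : ℕ} (c : HermCoord n) : 0 ≤ traceForm n c c := by
  have h := (Matrix.posSemidef_conjTranspose_mul_self (hermMatrix c)).trace_nonneg
  rw [(hermMatrix_isHermitian c).eq] at h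
  exact (Complex.le_def.1 h).1

/-- The real number `Re Tr V(M)` in Hermitian coordinates. -/
def potential {n : ℕ} (V : ℝ[X]) (c : HermCoord n) : ℝ :=
  (Matrix.trace (aeval (hermMatrix c) V)).re

theorem matrixDensity_eq (V W : ℝ[X]) (τ : ℝ) {n : ℕ} (c d : HermCoord n) :
    matrixDensity V W τ c d = Real.exp (-potential V c - potential W d + τ * traceForm n c d) := by
  simp [matrixDensity, potential, traceForm_apply]

theorem matrixDensity_swap (V W : ℝ[X]) (τ : ℝ) {n : ℕ} (c d : HermCoord n) :
    matrixDensity V W τ c d = matrixDensity W V τ d c := by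
  rw [matrixDensity_eq, matrixDensity_eq, traceForm_comm]
  ring_nf

theorem potential_of_natDegree_le_two {n : ℕ} {V : ℝ[X]} (hV : V.natDegree ≤ 2) (c : HermCoord n) :
    potential V c = V.coeff 2 * traceForm n c c + V.coeff 1 * (Matrix.trace (hermMatrix c)).re
      + V.coeff 0 * n := by
  have h : V = C (V.coeff 2) * X ^ 2 + C (V.coeff 1) * X + C (V.coeff 0) :=
    eq_quadratic_of_degree_le_two (natDegree_le_iff_degree_le.1 hV)
  conv_lhs => rw [potential, h]
  simp [traceForm_apply, sq, Matrix.algebraMap_eq_diagonal, Matrix.diagonal_mul,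
    Matrix.trace, Finset.mul_sum, Finset.sum_add_distrib]
  ring

/-- A function `f` with `f(x) + f(-x)` bounded below by a positive constant is not integrable on a
group of infinite volume. -/
theorem not_integrable_of_le_add_neg {E : Type*} [AddCommGroup E] [MeasurableSpace E]
    [TopologicalSpace E] [IsTopologicalAddGroup E] [BorelSpace E] [WeaklyLocallyCompactSpace E]
    [NoncompactSpace E] (μ : Measure E) [μ.IsAddHaarMeasure] [μ.IsNegInvariant] {f : E → ℝ} {c : ℝ}
    (hc : 0 < c) (hf : ∀ x, c ≤ f x + f (-x)) : ¬ Integrable f μ := by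
  intro hi
  have h2 : Integrable (fun x => f x + f (-x)) μ := hi.add hi.comp_neg
  have h3 : Integrable (fun _ : E => c) μ := by
    refine h2.mono (by fun_prop) (Filter.Eventually.of_forall fun x => ?_)
    rw [Real.norm_of_nonneg hc.le]
    exact (hf x).trans (le_abs_self _)
  rw [integrable_const_iff] at h3
  rcases h3 with h3 | h3
  · exact hc.ne' h3
  · exact (isFiniteMeasure_iff μ).1 h3 |>.ne (measure_univ_of_isAddLeftInvariant μ)

/-- If along every line `r ↦ (r M₁, M₂ + r κ M₁)` the exponent of the matrix density at `r = 0` is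
at most the mean of its values at `r = 1` and `r = -1`, then the sum of the densities at `±M₁` is
bounded below for fixed `M₂`, so the matrix integral diverges. -/
theorem not_integrable_matrixDensity {n : ℕ} (hn : 1 ≤ n) (V W : ℝ[X]) (τ κ : ℝ)
    (h : ∀ c d : HermCoord n,
      2 * (-potential V (0 : HermCoord n) - potential W d) ≤
        (-potential V c - potential W (d + κ • c) + τ * traceForm n c (d + κ • c)) +
        (-potential V (-c) - potential W (d + κ • -c) + τ * traceForm n (-c) (d + κ • -c))) :
    ¬ Integrable (fun M : HermCoord n × HermCoord n => matrixDensity V W τ M.1 M.2) := by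
  intro hi
  have : (volume : Measure (HermCoord n)).IsAddHaarMeasure :=
    Measure.prod.instIsAddHaarMeasure _ _
  have : (volume : Measure (HermCoord n)).Regular :=
    Measure.Regular.of_sigmaCompactSpace_of_isLocallyFiniteMeasure _
  have : (volume : Measure (HermCoord n)).IsNegInvariant :=
    Measure.IsAddHaarMeasure.isNegInvariant_of_regular _
  -- The shear `(M₁, M₂) ↦ (M₁, M₂ + κ M₁)` turns the lines into lines with `M₂` fixed.
  have hmp : MeasurePreserving (fun z : HermCoord n × HermCoord n => (z.1, z.2 + κ • z.1))
      volume volume := by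
    refine MeasurePreserving.skew_product (f := id) (g := fun a b => b + κ • a)
      (MeasurePreserving.id _) (by fun_prop) ?_
    exact Filter.Eventually.of_forall fun a => map_add_right_eq_self _ _
  have hi' := hmp.integrable_comp_of_integrable hi
  have hs := (Integrable.swap hi').prod_right_ae
  have : (ae (volume : Measure (HermCoord n))).NeBot := ae_neBot.2 fun h0 =>
    isOpen_univ.measure_ne_zero (volume : Measure (HermCoord n)) Set.univ_nonempty (by simp [h0])
  obtain ⟨d, hd⟩ := hs.exists
  have : Nonempty (Fin n) := ⟨⟨0, hn⟩⟩
  have : NoncompactSpace (HermCoord n) := by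
    apply Prod.noncompactSpace_left
  refine not_integrable_of_le_add_neg (volume : Measure (HermCoord n))
    (c := 2 * Real.exp (-potential V (0 : HermCoord n) - potential W d)) (by positivity) ?_ hd
  intro c
  simp only [Function.comp, Prod.swap, matrixDensity_eq]
  set a := -potential V c - potential W (d + κ • c) + τ * traceForm n c (d + κ • c) with ha
  set b := -potential V (-c) - potential W (d + κ • -c) + τ * traceForm n (-c) (d + κ • -c)
  have h1 := h c d
  rw [← ha] at h1
  have h2 : Real.exp (-potential V (0 : HermCoord n) - potential W d) ≤ Real.exp (a / 2 + b / 2) :=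
    Real.exp_le_exp.2 (by linarith)
  have h3 : Real.exp a = Real.exp (a / 2) ^ 2 := by rw [← Real.exp_nat_mul]; ring_nf
  have h4 : Real.exp b = Real.exp (b / 2) ^ 2 := by rw [← Real.exp_nat_mul]; ring_nf
  rw [Real.exp_add] at h2
  rw [h3, h4]
  nlinarith [sq_nonneg (Real.exp (a / 2) - Real.exp (b / 2))]

/-- For constant `V` the density, as a function of the first matrix, is the exponential of an affine
function. -/
theorem natDegree_ne_zero_of_integrable {n : ℕ} (hn : 1 ≤ n) {V W : ℝ[X]} {τ : ℝ}
    (hZ : Integrable (fun M : HermCoord n × HermCoord n => matrixDensity V W τ M.1 M.2)) :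
    V.natDegree ≠ 0 := by
  intro h0
  refine not_integrable_matrixDensity hn V W τ 0 ?_ hZ
  intro c d
  have h1 : ∀ k, 1 ≤ k → V.coeff k = 0 := fun k hk =>
    coeff_eq_zero_of_natDegree_lt (by omega)
  have h2 : ∀ c : HermCoord n, potential V c = V.coeff 0 * n := fun c => by
    rw [potential_of_natDegree_le_two (by omega), h1 1 le_rfl, h1 2 (by norm_num)]; ring
  simp only [h2, zero_smul, add_zero, map_neg, LinearMap.neg_apply]
  linarith

theorem lt_of_integrable_of_natDegree_eq_two {n : ℕ} (hn : 1 ≤ n) {V W : ℝ[X]} {τ : ℝ} (hτ : τ ≠ 0)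
    (hV : V.natDegree = 2) (hW : W.natDegree = 2) (hVl : 0 < V.leadingCoeff)
    (hZ : Integrable (fun M : HermCoord n × HermCoord n => matrixDensity V W τ M.1 M.2)) :
    τ ^ 2 < 4 * V.leadingCoeff * W.leadingCoeff := by
  by_contra hle
  push Not at hle
  have hVl' : V.coeff 2 = V.leadingCoeff := by rw [leadingCoeff, hV]
  have hWl' : W.coeff 2 = W.leadingCoeff := by rw [leadingCoeff, hW]
  -- In the direction `(M, κ M)` the quadratic part is `(-a - a' κ² + τ κ) Tr M²`, which is
  -- nonnegative at `κ = 2 a / τ`.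
  set κ := 2 * V.leadingCoeff / τ with hκ
  have hq : 0 ≤ -V.leadingCoeff - W.leadingCoeff * κ ^ 2 + τ * κ := by
    have : -V.leadingCoeff - W.leadingCoeff * κ ^ 2 + τ * κ
        = V.leadingCoeff * (τ ^ 2 - 4 * V.leadingCoeff * W.leadingCoeff) / τ ^ 2 := by
      rw [hκ]; field_simp; ring
    rw [this]
    exact div_nonneg (mul_nonneg hVl.le (by linarith)) (sq_nonneg _)
  refine not_integrable_matrixDensity hn V W τ κ ?_ hZ
  intro c d
  have htr0 : (Matrix.trace (hermMatrix (0 : HermCoord n))).re = 0 := by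
    have := hermMatrix_smul (0 : ℝ) (0 : HermCoord n)
    simp only [zero_smul] at this
    simp [this]
  have htr : ∀ r : ℝ, ∀ c : HermCoord n, (Matrix.trace (hermMatrix (r • c))).re
      = r * (Matrix.trace (hermMatrix c)).re := fun r c => by simp [hermMatrix_smul]
  have hneg : -c = (-1 : ℝ) • c := by simp
  rw [hneg]
  simp only [potential_of_natDegree_le_two hV.le, potential_of_natDegree_le_two hW.le, htr0,
    hermMatrix_add, Matrix.trace_add, Complex.add_re, htr, map_zero, map_add, map_smul,
    LinearMap.add_apply, LinearMap.smul_apply, smul_eq_mul, hVl', hWl', traceForm_comm d c]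
  have := mul_nonneg hq (traceForm_self_nonneg c)
  nlinarith [this]

/-- A real polynomial of positive even degree with positive leading coefficient is bounded below. -/
theorem exists_forall_neg_le_eval {V : ℝ[X]} (h0 : V.natDegree ≠ 0) (he : Even V.natDegree)
    (hl : 0 < V.leadingCoeff) : ∃ B, ∀ x, -B ≤ V.eval x := by
  have hdeg : 0 < V.degree := natDegree_pos_iff_degree_pos.1 (Nat.pos_of_ne_zero h0)
  have h1 : Filter.Tendsto (fun x => V.eval x) Filter.atTop Filter.atTop :=
    tendsto_atTop_of_leadingCoeff_nonneg V hdeg hl.le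
  have h2 : Filter.Tendsto (fun x => V.eval x) Filter.atBot Filter.atTop := by
    have hd : (V.comp (-X)).natDegree = V.natDegree := by simp [natDegree_comp]
    have hlc : (V.comp (-X)).leadingCoeff = V.leadingCoeff := by
      rw [leadingCoeff_comp (by simp)]; simp [he.neg_one_pow]
    have h3 := tendsto_atTop_of_leadingCoeff_nonneg (V.comp (-X))
      (natDegree_pos_iff_degree_pos.1 (by rw [hd]; exact Nat.pos_of_ne_zero h0))
      (by rw [hlc]; exact hl.le)
    have h4 := h3.comp Filter.tendsto_neg_atBot_atTop
    simpa [Function.comp_def] using h4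
  have h3 : Filter.Tendsto (fun x => V.eval x) (Filter.cocompact ℝ) Filter.atTop := by
    rw [cocompact_eq_atBot_atTop]; exact h2.sup h1
  obtain ⟨x, hx⟩ := V.continuous.exists_forall_le h3
  exact ⟨-V.eval x, fun y => by simpa using hx y⟩

/-- A polynomial of positive even degree with positive leading coefficient dominates `a x²` up to a
constant, where `a` is arbitrary unless the degree is `2`. -/
theorem exists_quadratic_le_eval {V : ℝ[X]} (h0 : V.natDegree ≠ 0) (he : Even V.natDegree)
    (hl : 0 < V.leadingCoeff) {a : ℝ} (ha : V.natDegree = 2 → a < V.leadingCoeff) :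
    ∃ B, ∀ x, a * x ^ 2 - B ≤ V.eval x := by
  have key : (V - C a * X ^ 2).natDegree = V.natDegree ∧ 0 < (V - C a * X ^ 2).leadingCoeff := by
    by_cases h2 : V.natDegree = 2
    · have hle : (V - C a * X ^ 2).natDegree ≤ 2 := by
        refine (natDegree_sub_le _ _).trans (max_le h2.le (natDegree_C_mul_X_pow_le _ _))
      have hc : (V - C a * X ^ 2).coeff 2 = V.leadingCoeff - a := by
        simp [leadingCoeff, h2]
      have hpos : 0 < V.leadingCoeff - a := sub_pos.2 (ha h2)
      have hd : (V - C a * X ^ 2).natDegree = 2 :=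
        le_antisymm hle (le_natDegree_of_ne_zero (by rw [hc]; exact hpos.ne'))
      exact ⟨hd.trans h2.symm, by rw [leadingCoeff, hd, hc]; exact hpos⟩
    · have h4 : 2 < V.natDegree := by
        obtain ⟨k, hk⟩ := he; omega
      have hlt : (C a * X ^ 2).natDegree < V.natDegree :=
        (natDegree_C_mul_X_pow_le _ _).trans_lt h4
      refine ⟨natDegree_sub_eq_left_of_natDegree_lt hlt, ?_⟩
      rw [leadingCoeff_sub_of_degree_lt (degree_lt_degree hlt)]
      exact hl
  obtain ⟨B, hB⟩ := exists_forall_neg_le_eval (V := V - C a * X ^ 2) (by rw [key.1]; exact h0)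
    (by rw [key.1]; exact he) key.2
  exact ⟨B, fun x => by have := hB x; simp at this; linarith⟩

/-- The weight decays like a Gaussian in both variables. -/
def GaussianBound (V W : ℝ[X]) (τ ε B : ℝ) : Prop :=
  ∀ x y, weight V W τ x y ≤ B * (Real.exp (-ε * x ^ 2) * Real.exp (-ε * y ^ 2))

theorem weight_swap (V W : ℝ[X]) (τ x y : ℝ) : weight V W τ x y = weight W V τ y x := by
  simp only [weight]; ring_nf

theorem GaussianBound.swap {V W : ℝ[X]} {τ ε B : ℝ} (h : GaussianBound V W τ ε B) :
    GaussianBound W V τ ε B := fun x y => by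
  rw [weight_swap, mul_comm (Real.exp _)]; exact h y x

theorem exists_gaussianBound_of_quadratic {V W : ℝ[X]} {τ a b A B : ℝ} (ha : 0 < a) (hb : 0 < b)
    (hab : τ ^ 2 < 4 * a * b) (hV : ∀ x, a * x ^ 2 - A ≤ V.eval x)
    (hW : ∀ x, b * x ^ 2 - B ≤ W.eval x) :
    ∃ ε > 0, ∃ B, GaussianBound V W τ ε B := by
  -- Subtracting `ε = (4ab - τ²) / (4(a+b))` from `a` and `b` keeps the quadratic form
  -- `a x² - τ x y + b y²` positive semidefinite.
  set ε := (4 * a * b - τ ^ 2) / (4 * (a + b)) with hε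
  have hεpos : 0 < ε := div_pos (by linarith) (by positivity)
  have hεeq : 4 * ε * (a + b) = 4 * a * b - τ ^ 2 := by rw [hε]; field_simp
  have hεa : 0 < a - ε := by
    have h1 : 4 * (a - ε) * (a + b) = 4 * a ^ 2 + τ ^ 2 := by linear_combination -hεeq
    have h2 : 0 < 4 * (a - ε) * (a + b) := by rw [h1]; positivity
    by_contra hcon
    push Not at hcon
    nlinarith [mul_nonneg (neg_nonneg.2 hcon) (add_pos ha hb).le]
  have hq : ∀ x y : ℝ, τ * x * y ≤ (a - ε) * x ^ 2 + (b - ε) * y ^ 2 := by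
    intro x y
    have h1 : 4 * (a - ε) * ((a - ε) * x ^ 2 + (b - ε) * y ^ 2 - τ * x * y)
        = (2 * (a - ε) * x - τ * y) ^ 2 + 4 * ε ^ 2 * y ^ 2 := by
      linear_combination (- y ^ 2) * hεeq
    have h2 : 0 ≤ 4 * (a - ε) * ((a - ε) * x ^ 2 + (b - ε) * y ^ 2 - τ * x * y) := by
      rw [h1]; positivity
    have := nonneg_of_mul_nonneg_right h2 (by positivity)
    linarith
  refine ⟨ε, hεpos, Real.exp (A + B), fun x y => ?_⟩
  rw [weight, ← Real.exp_add, ← Real.exp_add, Real.exp_le_exp]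
  linarith [hq x y, hV x, hW y]

theorem exists_gaussianBound {n : ℕ} (hn : 1 ≤ n) {V W : ℝ[X]}
    (hVdeg : Even V.natDegree) (hVlead : 0 < V.leadingCoeff)
    (hWdeg : Even W.natDegree) (hWlead : 0 < W.leadingCoeff) {τ : ℝ} (hτ : τ ≠ 0)
    (hZ : Integrable (fun M : HermCoord n × HermCoord n => matrixDensity V W τ M.1 M.2)) :
    ∃ ε > 0, ∃ B, GaussianBound V W τ ε B := by
  have hZ' : Integrable (fun M : HermCoord n × HermCoord n => matrixDensity W V τ M.1 M.2) := by
    refine hZ.swap.congr (Filter.Eventually.of_forall fun M => ?_)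
    exact matrixDensity_swap V W τ M.2 M.1
  have hV0 := natDegree_ne_zero_of_integrable hn hZ
  have hW0 := natDegree_ne_zero_of_integrable hn hZ'
  suffices h : ∃ a b, 0 < a ∧ 0 < b ∧ τ ^ 2 < 4 * a * b ∧
      (V.natDegree = 2 → a < V.leadingCoeff) ∧ (W.natDegree = 2 → b < W.leadingCoeff) by
    obtain ⟨a, b, ha, hb, hab, h1, h2⟩ := h
    obtain ⟨A, hA⟩ := exists_quadratic_le_eval hV0 hVdeg hVlead h1
    obtain ⟨B, hB⟩ := exists_quadratic_le_eval hW0 hWdeg hWlead h2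
    exact exists_gaussianBound_of_quadratic ha hb hab hA hB
  set v := V.leadingCoeff
  set w := W.leadingCoeff
  have hτ2 : 0 < τ ^ 2 := by positivity
  by_cases hV2 : V.natDegree = 2
  · by_cases hW2 : W.natDegree = 2
    · have hlt : τ ^ 2 < 4 * v * w :=
        lt_of_integrable_of_natDegree_eq_two hn hτ hV2 hW2 hVlead hZ
      -- Both leading coefficients shrink by the factor `(1 + r) / 2`, whose square exceeds `r`.
      set r := τ ^ 2 / (4 * v * w) with hr
      have hvw : 0 < 4 * v * w := by positivity
      have hr0 : 0 < r := by positivity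
      have hr1 : r < 1 := (div_lt_one hvw).2 hlt
      refine ⟨v * ((1 + r) / 2), w * ((1 + r) / 2), by positivity, by positivity, ?_,
        fun _ => ?_, fun _ => ?_⟩
      · have h1 : τ ^ 2 = r * (4 * v * w) := by rw [hr]; field_simp
        have h2 : r < ((1 + r) / 2) ^ 2 := by nlinarith [sq_pos_of_pos (sub_pos.2 hr1)]
        calc τ ^ 2 = r * (4 * v * w) := h1
          _ < ((1 + r) / 2) ^ 2 * (4 * v * w) := by gcongr
          _ = _ := by ring
      · nlinarith
      · nlinarith
    · refine ⟨v / 2, τ ^ 2 / v, by positivity, by positivity, ?_, fun _ => by linarith,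
        fun h => absurd h hW2⟩
      field_simp; linarith
  · refine ⟨τ ^ 2 / w, w / 2, by positivity, by positivity, ?_, fun h => absurd h hV2,
      fun _ => by linarith⟩
    field_simp; linarith

/-! ### Integrability and bounds for the weight and its transforms -/

theorem weight_pos (V W : ℝ[X]) (τ x y : ℝ) : 0 < weight V W τ x y := Real.exp_pos _

theorem continuous_weight (V W : ℝ[X]) (τ : ℝ) :
    Continuous fun z : ℝ × ℝ => weight V W τ z.1 z.2 := by
  unfold weight
  fun_prop

theorem exists_abs_eval_le_exp (f : ℝ[X]) {δ : ℝ} (hδ : 0 < δ) :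
    ∃ A, 0 < A ∧ ∀ x, |f.eval x| ≤ A * Real.exp (δ * x ^ 2) := by
  induction f using Polynomial.induction_on' with
  | add f g hf hg =>
    obtain ⟨A, hA, h1⟩ := hf
    obtain ⟨B, hB, h2⟩ := hg
    refine ⟨A + B, by positivity, fun x => ?_⟩
    rw [eval_add, add_mul]
    exact (abs_add_le _ _).trans (add_le_add (h1 x) (h2 x))
  | monomial k a =>
    -- `|x|^k ≤ 1 + x^(2k)`, and `(δ x²)^k / k!` is a term of the exponential series.
    refine ⟨|a| * (1 + k.factorial / δ ^ k) + 1, by positivity, fun x => ?_⟩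
    have h1 : |x| ^ k ≤ 1 + (x ^ 2) ^ k := by
      have : (x ^ 2) ^ k = (|x| ^ k) ^ 2 := by rw [← sq_abs]; ring
      rw [this]
      nlinarith [sq_nonneg (|x| ^ k - 1), sq_nonneg (|x| ^ k)]
    have h2 := Real.pow_div_factorial_le_exp (δ * x ^ 2) (by positivity) k
    have h3 : (x ^ 2) ^ k ≤ k.factorial / δ ^ k * Real.exp (δ * x ^ 2) := by
      calc (x ^ 2) ^ k = k.factorial / δ ^ k * ((δ * x ^ 2) ^ k / k.factorial) := by
            rw [mul_pow]; field_simp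
        _ ≤ _ := by gcongr
    have h4 : 1 ≤ Real.exp (δ * x ^ 2) := Real.one_le_exp (by positivity)
    rw [eval_monomial, abs_mul, abs_pow]
    calc |a| * |x| ^ k ≤ |a| * (Real.exp (δ * x ^ 2)
          + k.factorial / δ ^ k * Real.exp (δ * x ^ 2)) := by
            gcongr; linarith
      _ ≤ _ := by nlinarith [Real.exp_pos (δ * x ^ 2)]

theorem exists_abs_eval_mul_exp_le (f : ℝ[X]) {ε : ℝ} (hε : 0 < ε) :
    ∃ A, 0 < A ∧ ∀ x, |f.eval x| * Real.exp (-ε * x ^ 2) ≤ A * Real.exp (-(ε / 2) * x ^ 2) := by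
  obtain ⟨A, hA, h⟩ := exists_abs_eval_le_exp f (half_pos hε)
  refine ⟨A, hA, fun x => ?_⟩
  calc |f.eval x| * Real.exp (-ε * x ^ 2)
      ≤ A * Real.exp (ε / 2 * x ^ 2) * Real.exp (-ε * x ^ 2) := by gcongr; exact h x
    _ = A * Real.exp (-(ε / 2) * x ^ 2) := by
      rw [mul_assoc, ← Real.exp_add]; congr 2; ring

theorem integrable_abs_eval_mul_exp (f : ℝ[X]) {ε : ℝ} (hε : 0 < ε) :
    Integrable fun x : ℝ => |f.eval x| * Real.exp (-ε * x ^ 2) := by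
  obtain ⟨A, -, h⟩ := exists_abs_eval_mul_exp_le f hε
  refine ((integrable_exp_neg_mul_sq (half_pos hε)).const_mul A).mono'
    (by fun_prop) (Filter.Eventually.of_forall fun x => ?_)
  rw [Real.norm_of_nonneg (by positivity)]
  exact h x

variable {V W : ℝ[X]} {τ ε B : ℝ}

theorem GaussianBound.pos (h : GaussianBound V W τ ε B) : 0 < B := by
  by_contra hB
  have h1 := h 0 0
  have h2 := weight_pos V W τ 0 0
  simp at h1
  linarith

theorem GaussianBound.integrable_mul_weight (h : GaussianBound V W τ ε B) (hε : 0 < ε)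
    (f g : ℝ[X]) :
    Integrable fun z : ℝ × ℝ => f.eval z.1 * g.eval z.2 * weight V W τ z.1 z.2 := by
  have hi := ((integrable_abs_eval_mul_exp f hε).mul_prod
    (integrable_abs_eval_mul_exp g hε)).const_mul B
  refine hi.mono' ?_ (Filter.Eventually.of_forall fun z => ?_)
  · have := continuous_weight V W τ
    fun_prop
  · rw [Real.norm_eq_abs, abs_mul, abs_mul, abs_of_pos (weight_pos ..)]
    calc |f.eval z.1| * |g.eval z.2| * weight V W τ z.1 z.2
        ≤ |f.eval z.1| * |g.eval z.2| *
          (B * (Real.exp (-ε * z.1 ^ 2) * Real.exp (-ε * z.2 ^ 2))) := by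
          gcongr; exact h _ _
      _ = _ := by ring

theorem GaussianBound.integrable_eval_mul_weight (h : GaussianBound V W τ ε B) (hε : 0 < ε)
    (f : ℝ[X]) (y : ℝ) : Integrable fun x : ℝ => f.eval x * weight V W τ x y := by
  refine ((integrable_abs_eval_mul_exp f hε).const_mul (B * Real.exp (-ε * y ^ 2))).mono' ?_
    (Filter.Eventually.of_forall fun x => ?_)
  · have : Continuous fun x => weight V W τ x y := by unfold weight; fun_prop
    fun_prop
  · rw [Real.norm_eq_abs, abs_mul, abs_of_pos (weight_pos ..)]
    calc |f.eval x| * weight V W τ x y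
        ≤ |f.eval x| * (B * (Real.exp (-ε * x ^ 2) * Real.exp (-ε * y ^ 2))) := by
          gcongr; exact h _ _
      _ = _ := by ring

/-- The pairing as a bilinear form on polynomials. -/
def GaussianBound.pairingForm (h : GaussianBound V W τ ε B) (hε : 0 < ε) :
    ℝ[X] →ₗ[ℝ] ℝ[X] →ₗ[ℝ] ℝ :=
  LinearMap.mk₂ ℝ (pairing V W τ)
    (fun f f' g => by
      simp only [pairing]
      rw [← integral_add (h.integrable_mul_weight hε f g) (h.integrable_mul_weight hε f' g)]
      simp only [eval_add, add_mul])
    (fun r f g => by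
      simp only [pairing, smul_eq_mul]
      rw [← integral_const_mul]
      simp only [eval_smul, smul_eq_mul, mul_assoc])
    (fun f g g' => by
      simp only [pairing]
      rw [← integral_add (h.integrable_mul_weight hε f g) (h.integrable_mul_weight hε f g')]
      simp only [eval_add, mul_add, add_mul])
    (fun r f g => by
      simp only [pairing, smul_eq_mul]
      rw [← integral_const_mul]
      congr 1; ext z; simp only [eval_smul, smul_eq_mul]; ring)

theorem GaussianBound.pairingForm_apply (h : GaussianBound V W τ ε B) (hε : 0 < ε) (f g : ℝ[X]) :
    h.pairingForm hε f g = pairing V W τ f g := rfl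

theorem pairing_swap (V W : ℝ[X]) (τ : ℝ) (f g : ℝ[X]) :
    pairing V W τ f g = pairing W V τ g f := by
  simp only [pairing, Measure.volume_eq_prod]
  rw [← integral_prod_swap (μ := (volume : Measure ℝ)) (ν := (volume : Measure ℝ))
    (fun z : ℝ × ℝ => g.eval z.1 * f.eval z.2 * weight W V τ z.1 z.2)]
  refine integral_congr_ae (Filter.Eventually.of_forall fun z => ?_)
  simp only [Prod.fst_swap, Prod.snd_swap]
  rw [weight_swap V W]; ring

/-- The transform `y ↦ ∫ f(x) exp (-V(x) - W(y) + τ x y) dx` of a polynomial. -/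
def transform (V W : ℝ[X]) (τ : ℝ) (f : ℝ[X]) (y : ℝ) : ℝ :=
  ∫ x : ℝ, f.eval x * weight V W τ x y

theorem transP_eq_transform (p : ℕ → ℝ[X]) (i : ℕ) (y : ℝ) :
    transP V W τ p i y = transform V W τ (p i) y := rfl

theorem transQ_eq_transform (q : ℕ → ℝ[X]) (j : ℕ) (x : ℝ) :
    transQ V W τ q j x = transform W V τ (q j) x := by
  simp only [transQ, transform, weight_swap V W]

theorem GaussianBound.integrable_transform_mul (h : GaussianBound V W τ ε B) (hε : 0 < ε)
    (f g : ℝ[X]) : Integrable fun y => transform V W τ f y * g.eval y := by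
  have hi := h.integrable_mul_weight hε f g
  rw [Measure.volume_eq_prod] at hi
  refine hi.integral_prod_right.congr (Filter.Eventually.of_forall fun y => ?_)
  simp only [transform]
  rw [← integral_mul_const]
  congr 1; ext x; ring

theorem GaussianBound.integral_transform_mul (h : GaussianBound V W τ ε B) (hε : 0 < ε)
    (f g : ℝ[X]) : ∫ y, transform V W τ f y * g.eval y = pairing V W τ f g := by
  have hi := h.integrable_mul_weight hε f g
  rw [Measure.volume_eq_prod] at hi
  rw [pairing, Measure.volume_eq_prod, integral_prod_symm _ hi]
  congr 1; ext y
  rw [transform, ← integral_mul_const]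
  congr 1; ext x; ring

theorem GaussianBound.exists_abs_transform_le (h : GaussianBound V W τ ε B) (hε : 0 < ε)
    (f : ℝ[X]) : ∃ A, 0 < A ∧ ∀ y, |transform V W τ f y| ≤ A * Real.exp (-ε * y ^ 2) := by
  refine ⟨B * (∫ x, |f.eval x| * Real.exp (-ε * x ^ 2)) + 1, ?_, fun y => ?_⟩
  · have : 0 ≤ ∫ x, |f.eval x| * Real.exp (-ε * x ^ 2) :=
      integral_nonneg fun x => by positivity
    have := h.pos
    positivity
  · have h1 : |transform V W τ f y| ≤
        ∫ x, B * Real.exp (-ε * y ^ 2) * (|f.eval x| * Real.exp (-ε * x ^ 2)) := by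
      rw [← Real.norm_eq_abs, transform]
      refine norm_integral_le_of_norm_le
        ((integrable_abs_eval_mul_exp f hε).const_mul _) (Filter.Eventually.of_forall fun x => ?_)
      rw [Real.norm_eq_abs, abs_mul, abs_of_pos (weight_pos ..)]
      calc |f.eval x| * weight V W τ x y
          ≤ |f.eval x| * (B * (Real.exp (-ε * x ^ 2) * Real.exp (-ε * y ^ 2))) := by
            gcongr; exact h _ _
        _ = _ := by ring
    rw [integral_const_mul] at h1
    have := Real.exp_pos (-ε * y ^ 2)
    linarith

/-! ### Zeros of two-sided Laplace transforms -/

/-- The two-sided Laplace transform `y ↦ ∫ f(x) exp (-V(x)) exp (τ x y) dx`. -/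
def laplace (V : ℝ[X]) (τ : ℝ) (f : ℝ[X]) (y : ℝ) : ℝ :=
  ∫ x : ℝ, f.eval x * Real.exp (-V.eval x + τ * x * y)

theorem transform_eq_laplace (V W : ℝ[X]) (τ : ℝ) (f : ℝ[X]) (y : ℝ) :
    transform V W τ f y = Real.exp (-W.eval y) * laplace V τ f y := by
  rw [transform, laplace, ← integral_const_mul]
  congr 1; ext x
  rw [weight, show -V.eval x - W.eval y + τ * x * y = -W.eval y + (-V.eval x + τ * x * y) by ring,
    Real.exp_add]
  ring

theorem GaussianBound.integrable_laplace (h : GaussianBound V W τ ε B) (hε : 0 < ε) (f : ℝ[X])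
    (y : ℝ) : Integrable fun x : ℝ => f.eval x * Real.exp (-V.eval x + τ * x * y) := by
  refine ((h.integrable_eval_mul_weight hε f y).const_mul (Real.exp (W.eval y))).congr
    (Filter.Eventually.of_forall fun x => ?_)
  simp only [weight]
  rw [mul_left_comm, ← Real.exp_add]
  congr 2; ring

theorem GaussianBound.hasDerivAt_laplace (h : GaussianBound V W τ ε B) (hε : 0 < ε) (f : ℝ[X])
    (y : ℝ) : HasDerivAt (laplace V τ f) (τ * laplace V τ (X * f) y) y := by
  have hV : ∀ x, Real.exp (-V.eval x) ≤ B * Real.exp (W.eval 0) * Real.exp (-ε * x ^ 2) := by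
    intro x
    have h1 := h x 0
    simp only [weight, mul_zero, add_zero, zero_pow two_ne_zero, Real.exp_zero, mul_one] at h1
    calc Real.exp (-V.eval x) = Real.exp (W.eval 0) * Real.exp (-V.eval x - W.eval 0) := by
          rw [← Real.exp_add]; congr 1; ring
      _ ≤ Real.exp (W.eval 0) * (B * Real.exp (-ε * x ^ 2)) := by gcongr
      _ = _ := by ring
  set k := |τ| * (|y| + 1) with hk
  set M := B * Real.exp (W.eval 0) * Real.exp (k ^ 2 / (2 * ε)) with hM
  have hint : Integrable fun x : ℝ => M * (|(C τ * X * f).eval x| * Real.exp (-(ε / 2) * x ^ 2)) :=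
    (integrable_abs_eval_mul_exp _ (half_pos hε)).const_mul M
  have hB := h.pos
  have key := (hasDerivAt_integral_of_dominated_loc_of_deriv_le (μ := volume) (x₀ := y)
    (F := fun y x => f.eval x * Real.exp (-V.eval x + τ * x * y))
    (F' := fun y x => f.eval x * (Real.exp (-V.eval x + τ * x * y) * (τ * x)))
    (bound := fun x => M * (|(C τ * X * f).eval x| * Real.exp (-(ε / 2) * x ^ 2)))
    (Metric.ball_mem_nhds y one_pos)
    (Filter.Eventually.of_forall fun y => by fun_prop)
    (h.integrable_laplace hε f y) (by fun_prop)
    (Filter.Eventually.of_forall fun x z hz => ?_) hint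
    (Filter.Eventually.of_forall fun x z hz => ?_)).2
  · refine key.congr_deriv ?_
    rw [laplace, ← integral_const_mul]
    congr 1; ext x; simp; ring
  · have hz' : |z| ≤ |y| + 1 := by
      rw [Metric.mem_ball, Real.dist_eq] at hz
      have := abs_sub_abs_le_abs_sub z y
      linarith
    have h2 : τ * x * z ≤ ε / 2 * x ^ 2 + k ^ 2 / (2 * ε) := by
      have h3 : τ * x * z ≤ k * |x| := by
        calc τ * x * z ≤ |τ * x * z| := le_abs_self _
          _ = |τ| * |z| * |x| := by rw [abs_mul, abs_mul]; ring
          _ ≤ |τ| * (|y| + 1) * |x| := by gcongr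
      have h4 : ε / 2 * x ^ 2 + k ^ 2 / (2 * ε) - k * |x| = (ε * |x| - k) ^ 2 / (2 * ε) := by
        rw [← sq_abs x]; field_simp; ring
      have h5 : 0 ≤ (ε * |x| - k) ^ 2 / (2 * ε) := by positivity
      linarith
    rw [Real.norm_eq_abs, abs_mul, abs_mul, Real.abs_exp]
    have h6 : Real.exp (-V.eval x + τ * x * z) ≤ M * Real.exp (-(ε / 2) * x ^ 2) := by
      rw [Real.exp_add]
      calc Real.exp (-V.eval x) * Real.exp (τ * x * z)
          ≤ (B * Real.exp (W.eval 0) * Real.exp (-ε * x ^ 2)) *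
            Real.exp (ε / 2 * x ^ 2 + k ^ 2 / (2 * ε)) := by
            gcongr; exact hV x
        _ = M * (Real.exp (-ε * x ^ 2) * Real.exp (ε / 2 * x ^ 2)) := by
            rw [Real.exp_add, hM]; ring
        _ = M * Real.exp (-(ε / 2) * x ^ 2) := by
            rw [← Real.exp_add]; congr 2; ring
    calc |f.eval x| * (Real.exp (-V.eval x + τ * x * z) * |τ * x|)
        ≤ |f.eval x| * ((M * Real.exp (-(ε / 2) * x ^ 2)) * |τ * x|) := by gcongr
      _ = _ := by simp [abs_mul]; ring
  · have h1 : HasDerivAt (fun y => -V.eval x + τ * x * y) (τ * x) z := by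
      simpa using ((hasDerivAt_id z).const_mul (τ * x)).const_add (-V.eval x)
    exact (h1.exp).const_mul (f.eval x)

theorem GaussianBound.continuous_laplace (h : GaussianBound V W τ ε B) (hε : 0 < ε) (f : ℝ[X]) :
    Continuous (laplace V τ f) :=
  continuous_iff_continuousAt.2 fun y => (h.hasDerivAt_laplace hε f y).continuousAt

theorem GaussianBound.continuous_transform (h : GaussianBound V W τ ε B) (hε : 0 < ε) (f : ℝ[X]) :
    Continuous (transform V W τ f) := by
  have h1 : transform V W τ f = fun y => Real.exp (-W.eval y) * laplace V τ f y :=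
    funext fun y => transform_eq_laplace V W τ f y
  rw [h1]
  have := h.continuous_laplace hε f
  fun_prop

/-- Rolle's theorem: between `k + 1` zeros of a differentiable function lie `k` zeros of its
derivative. -/
theorem exists_finset_deriv_eq_zero {f f' : ℝ → ℝ} (hf : ∀ x, HasDerivAt f (f' x) x)
    (Z : Finset ℝ) (hZ : ∀ z ∈ Z, f z = 0) :
    ∃ Z' : Finset ℝ, (∀ z ∈ Z', f' z = 0) ∧ Z.card ≤ Z'.card + 1 := by
  rcases Nat.eq_zero_or_pos Z.card with h0 | hpos
  · exact ⟨∅, by simp, by omega⟩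
  obtain ⟨k, hk⟩ : ∃ k, Z.card = k + 1 := ⟨Z.card - 1, by omega⟩
  let e := Z.orderEmbOfFin hk
  have he : ∀ i, f (e i) = 0 := fun i => hZ _ (Z.orderEmbOfFin_mem hk i)
  have hroot : ∀ i : Fin k, ∃ c ∈ Set.Ioo (e i.castSucc) (e i.succ), f' c = 0 := fun i =>
    exists_hasDerivAt_eq_zero (e.strictMono i.castSucc_lt_succ)
      (fun x _ => (hf x).continuousAt.continuousWithinAt) (by rw [he, he]) fun x _ => hf x
  choose c hc hc0 using hroot
  have hmono : StrictMono c := by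
    intro i j hij
    calc c i < e i.succ := (hc i).2
      _ ≤ e j.castSucc := e.monotone (by rw [Fin.le_def]; simpa using hij)
      _ < c j := (hc j).1
  refine ⟨Finset.univ.image c, ?_, ?_⟩
  · simpa using hc0
  · rw [Finset.card_image_of_injective _ hmono.injective, hk]; simp

theorem GaussianBound.laplace_pos (h : GaussianBound V W τ ε B) (hε : 0 < ε) {f : ℝ[X]}
    (hf : f ≠ 0) (hnn : ∀ x, 0 ≤ f.eval x) (y : ℝ) : 0 < laplace V τ f y := by
  obtain ⟨x, hx⟩ : ∃ x, f.eval x ≠ 0 := by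
    by_contra! hcon
    exact hf (Polynomial.funext (by simpa using hcon))
  refine integral_pos_of_integrable_nonneg_nonzero (x := x) (by fun_prop)
    (h.integrable_laplace hε f y) (fun x => mul_nonneg (hnn x) (Real.exp_pos _).le) ?_
  exact mul_ne_zero hx (Real.exp_pos _).ne'

/-- If the sign changes of `f` are among the points of `s`, then the Laplace transform of `f` has at
most as many zeros as `s` has elements. Multiplying `f` by `X - c` differentiates the transform up
to nonvanishing factors, so that by Rolle's theorem at most one zero is lost. -/
theorem GaussianBound.card_zeros_laplace_le (h : GaussianBound V W τ ε B) (hε : 0 < ε)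
    (hτ : τ ≠ 0) (s : Multiset ℝ) : ∀ {f : ℝ[X]}, f ≠ 0 →
    (∀ x, 0 ≤ ((s.map fun c => X - C c).prod * f).eval x) →
    ∀ Z : Finset ℝ, (∀ z ∈ Z, laplace V τ f z = 0) → Z.card ≤ Multiset.card s := by
  induction s using Multiset.induction_on with
  | empty =>
    intro f hf hnn Z hZ
    rw [Multiset.card_zero, Nat.le_zero, Finset.card_eq_zero, Finset.eq_empty_iff_forall_notMem]
    intro z hz
    exact (h.laplace_pos hε hf (by simpa using hnn) z).ne' (hZ z hz)
  | cons c s ih =>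
    intro f hf hnn Z hZ
    have hd : ∀ y, HasDerivAt (fun y => Real.exp (-(τ * c) * y) * laplace V τ f y)
        (Real.exp (-(τ * c) * y) * (τ * laplace V τ ((X - C c) * f) y)) y := by
      intro y
      have h1 : HasDerivAt (fun y => -(τ * c) * y) (-(τ * c)) y := by
        simpa using (hasDerivAt_id y).const_mul (-(τ * c))
      have h2 := h1.exp.mul (h.hasDerivAt_laplace hε f y)
      refine h2.congr_deriv ?_
      have h3 : laplace V τ ((X - C c) * f) y = laplace V τ (X * f) y - c * laplace V τ f y := by
        simp only [laplace]
        rw [← integral_const_mul, ← integral_sub (h.integrable_laplace hε _ y)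
          ((h.integrable_laplace hε _ y).const_mul c)]
        congr 1; ext x; simp; ring
      rw [h3]; ring
    obtain ⟨Z', hZ', hcard⟩ := exists_finset_deriv_eq_zero hd Z fun z hz => by
      rw [hZ z hz, mul_zero]
    have h4 := ih (f := (X - C c) * f) (mul_ne_zero (X_sub_C_ne_zero c) hf)
      (fun x => by
        have := hnn x
        rw [Multiset.map_cons, Multiset.prod_cons] at this
        rwa [← mul_assoc, mul_comm _ (X - C c)])
      Z' fun z hz => by
        have := hZ' z hz
        simpa [hτ, (Real.exp_pos _).ne'] using this
    rw [Multiset.card_cons]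
    omega

theorem pos_or_neg_of_forall_ne_zero {F : ℝ → ℝ} {s : Set ℝ} (hs : s.OrdConnected)
    (hF : ContinuousOn F s) (h0 : ∀ x ∈ s, F x ≠ 0) :
    (∀ x ∈ s, 0 < F x) ∨ (∀ x ∈ s, F x < 0) := by
  by_contra! hcon
  obtain ⟨⟨a, ha, hFa⟩, b, hb, hFb⟩ := hcon
  obtain ⟨c, hc, hc0⟩ := hs.isPreconnected.intermediate_value ha hb hF ⟨hFa, hFb⟩
  exact h0 c hc hc0

/-! ### Nondegeneracy of the pairing -/

/-- A continuous function with finitely many zeros has the sign of some polynomial whose degree is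
at most the number of zeros. -/
theorem exists_polynomial_mul_nonneg (Z : Finset ℝ) : ∀ {F : ℝ → ℝ}, Continuous F →
    (∀ x, F x = 0 ↔ x ∈ Z) →
    ∃ q : ℝ[X], q ≠ 0 ∧ q.natDegree ≤ Z.card ∧ ∀ x, 0 ≤ F x * q.eval x := by
  induction Z using Finset.induction_on_max with
  | empty =>
    intro F hF h0
    rcases pos_or_neg_of_forall_ne_zero Set.ordConnected_univ hF.continuousOn
      (fun x _ => by simp [h0 x]) with h | h
    · exact ⟨1, one_ne_zero, by simp, fun x => by simpa using (h x trivial).le⟩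
    · exact ⟨-1, by simp, by simp, fun x => by simpa using (h x trivial).le⟩
  | insert a s has ih =>
    intro F hF h0
    -- Freezing `F` at a point `c` between the last zero `a` and the others removes that zero.
    obtain ⟨c, hca, hcs⟩ : ∃ c < a, ∀ y ∈ s, y < c := by
      have h1 : ∀ᶠ c in nhdsWithin a (Set.Iio a), ∀ y ∈ s, y < c :=
        (Finset.eventually_all s).2 fun y hy =>
          nhdsWithin_le_nhds (eventually_gt_nhds (has y hy))
      obtain ⟨c, h2, h3⟩ := (h1.and self_mem_nhdsWithin).exists
      exact ⟨c, h3, h2⟩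
    have hcn : F c ≠ 0 := fun hc => by
      rcases Finset.mem_insert.1 ((h0 c).1 hc) with h | h
      · exact hca.ne h
      · exact lt_irrefl _ (hcs c h)
    obtain ⟨q, hq0, hqd, hq⟩ := ih (F := fun x => F (min x c)) (by fun_prop) (fun x => by
      rw [h0, Finset.mem_insert]
      rcases lt_or_ge x c with hx | hx
      · rw [min_eq_left hx.le]
        exact ⟨fun h => h.resolve_left (hx.trans hca).ne, Or.inr⟩
      · rw [min_eq_right hx]
        constructor
        · rintro (h | h)
          · exact absurd h hca.ne
          · exact absurd (hcs c h) (lt_irrefl _)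
        · exact fun h => absurd (hcs x h) (not_lt.2 hx))
    have hFa : F a = 0 := (h0 a).2 (Finset.mem_insert_self _ _)
    have hlow : ∀ x < a, 0 ≤ F x * q.eval x := by
      intro x hx
      rcases lt_or_ge x c with hxc | hxc
      · simpa [min_eq_left hxc.le] using hq x
      · have h1 := hq x
        simp only [min_eq_right hxc] at h1
        have h2 := pos_or_neg_of_forall_ne_zero (F := F) 
          (Set.ordConnected_Ico (a := c) (b := a)) hF.continuousOn (fun y hy hy0 => by
            rcases Finset.mem_insert.1 ((h0 y).1 hy0) with h | h
            · exact hy.2.ne h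
            · exact absurd (hcs y h) (not_lt.2 hy.1))
        rcases h2 with h2 | h2
        · exact mul_nonneg (h2 x ⟨hxc, hx⟩).le
            (nonneg_of_mul_nonneg_right h1 (h2 c ⟨le_rfl, hca⟩))
        · exact mul_nonneg_of_nonpos_of_nonpos (h2 x ⟨hxc, hx⟩).le
            (nonpos_of_mul_nonneg_right h1 (h2 c ⟨le_rfl, hca⟩))
    have hhigh : (∀ x ∈ Set.Ioi a, 0 < F x) ∨ (∀ x ∈ Set.Ioi a, F x < 0) :=
      pos_or_neg_of_forall_ne_zero Set.ordConnected_Ioi hF.continuousOn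
        (fun y hy hy0 => by
          rcases Finset.mem_insert.1 ((h0 y).1 hy0) with h | h
          · exact (ne_of_gt hy) h
          · exact absurd (has y h) (not_lt.2 (le_of_lt hy)))
    have hqhigh : ∀ x, a < x → 0 ≤ F c * q.eval x := fun x hx => by
      simpa [min_eq_right (hca.trans hx).le] using hq x
    have hcard : (insert a s).card = s.card + 1 :=
      Finset.card_insert_of_notMem fun h => lt_irrefl _ (has a h)
    by_cases hsame : ∀ x, a < x → 0 < F x * F c
    · refine ⟨q, hq0, by omega, fun x => ?_⟩
      rcases lt_trichotomy x a with hx | hx | hx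
      · exact hlow x hx
      · rw [hx, hFa, zero_mul]
      · have h1 := mul_nonneg (hsame x hx).le (hqhigh x hx)
        have h2 : 0 < F c ^ 2 := by positivity
        refine nonneg_of_mul_nonneg_right (a := F c ^ 2) ?_ h2
        linarith
    · refine ⟨q * (C a - X), mul_ne_zero hq0 ?_, ?_, fun x => ?_⟩
      · rw [← neg_sub, neg_ne_zero]; exact X_sub_C_ne_zero a
      · refine natDegree_mul_le.trans ?_
        have : (C a - X : ℝ[X]).natDegree = 1 := by
          rw [← neg_sub, natDegree_neg, natDegree_X_sub_C]
        omega
      · have hopp : ∀ x, a < x → F x * F c < 0 := by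
          push Not at hsame
          obtain ⟨y, hy, hyc⟩ := hsame
          intro x hx
          rcases hhigh with h | h
          · have : F c < 0 := lt_of_le_of_ne (nonpos_of_mul_nonpos_right hyc (h y hy)) hcn
            exact mul_neg_of_pos_of_neg (h x hx) this
          · have : 0 < F c := lt_of_le_of_ne (by
              by_contra! hlt
              exact absurd hyc (not_le.2 (mul_pos_of_neg_of_neg (h y hy) hlt))) hcn.symm
            exact mul_neg_of_neg_of_pos (h x hx) this
        simp only [eval_mul, eval_sub, eval_C, eval_X]
        rcases lt_trichotomy x a with hx | hx | hx
        · rw [← mul_assoc]; exact mul_nonneg (hlow x hx) (by linarith)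
        · rw [hx, hFa, zero_mul]
        · have h1 : 0 ≤ (F x * F c) * (F c * q.eval x) * (a - x) := by
            have := mul_nonneg (mul_nonneg (neg_nonneg.2 (hopp x hx).le) (hqhigh x hx))
              (sub_nonneg.2 hx.le)
            linarith
          have h2 : 0 < F c ^ 2 := by positivity
          refine nonneg_of_mul_nonneg_right (a := F c ^ 2) ?_ h2
          linarith

/-- The product of a polynomial with the linear factors of its real roots is a square times a factor
of constant sign, so the roots bound the number of zeros of the transform. -/
theorem GaussianBound.card_zeros_laplace_le_natDegree (h : GaussianBound V W τ ε B) (hε : 0 < ε)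
    (hτ : τ ≠ 0) {f : ℝ[X]} (hf : f ≠ 0) (Z : Finset ℝ) (hZ : ∀ z ∈ Z, laplace V τ f z = 0) :
    Z.card ≤ f.natDegree := by
  obtain ⟨u, hu, hdeg, hroots⟩ := exists_prod_multiset_X_sub_C_mul f
  have hu0 : u ≠ 0 := by rintro rfl; simp at hu; exact hf hu.symm
  have hne : ∀ x ∈ Set.univ, u.eval x ≠ 0 := fun x _ hx => by
    have : x ∈ u.roots := (mem_roots hu0).2 hx
    simp [hroots] at this
  have hsq : ∀ x, ((f.roots.map fun c => X - C c).prod * f).eval x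
      = (((f.roots.map fun c => X - C c).prod).eval x) ^ 2 * u.eval x := fun x => by
    conv_lhs => rw [eval_mul, ← hu, eval_mul, hu]
    ring
  refine le_trans ?_ (by omega : Multiset.card f.roots ≤ f.natDegree)
  rcases pos_or_neg_of_forall_ne_zero Set.ordConnected_univ u.continuous.continuousOn hne
    with hpos | hneg
  · refine h.card_zeros_laplace_le hε hτ f.roots hf (fun x => ?_) Z hZ
    rw [hsq]
    exact mul_nonneg (sq_nonneg _) (hpos x trivial).le
  · refine h.card_zeros_laplace_le hε hτ f.roots (neg_ne_zero.2 hf) (fun x => ?_) Z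
      fun z hz => ?_
    · rw [mul_neg, eval_neg, hsq, ← mul_neg]
      exact mul_nonneg (sq_nonneg _) (neg_nonneg.2 (hneg x trivial).le)
    · have := hZ z hz
      simp only [laplace, eval_neg, neg_mul, integral_neg, neg_eq_zero] at this ⊢
      exact this

/-- The pairing is nondegenerate on polynomials of bounded degree: `g` is chosen to have the sign of
the transform of `f`, so that the pairing is the integral of a nonnegative function. -/
theorem GaussianBound.exists_pairing_ne_zero (h : GaussianBound V W τ ε B) (hε : 0 < ε)
    (hτ : τ ≠ 0) {f : ℝ[X]} (hf : f ≠ 0) :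
    ∃ g : ℝ[X], g.natDegree ≤ f.natDegree ∧ pairing V W τ f g ≠ 0 := by
  have hfin : {y | laplace V τ f y = 0}.Finite := by
    by_contra hinf
    obtain ⟨Z, hZ, hcard⟩ := Set.Infinite.exists_subset_card_eq hinf (f.natDegree + 1)
    have := h.card_zeros_laplace_le_natDegree hε hτ hf Z fun z hz => hZ hz
    omega
  obtain ⟨q, hq0, hqd, hq⟩ := exists_polynomial_mul_nonneg hfin.toFinset
    (h.continuous_laplace hε f) (by simp)
  refine ⟨q, hqd.trans (h.card_zeros_laplace_le_natDegree hε hτ hf _ (by simp)), ?_⟩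
  rw [← h.integral_transform_mul hε]
  obtain ⟨y, hy⟩ := (hfin.union (q.finite_setOfPred_isRoot hq0)).infinite_compl.nonempty
  simp only [Set.compl_union, Set.mem_inter_iff, Set.mem_compl_iff, Set.mem_ofPred_eq] at hy
  have hi := h.integrable_transform_mul hε f q
  refine (integral_pos_of_integrable_nonneg_nonzero (x := y)
    ((h.continuous_transform hε f).mul q.continuous) hi (fun y => ?_) ?_).ne'
  · simp only [Pi.zero_apply, Pi.mul_apply]
    rw [transform_eq_laplace, mul_assoc]
    exact mul_nonneg (Real.exp_pos _).le (hq y)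
  · rw [Pi.mul_apply, transform_eq_laplace]
    exact mul_ne_zero (mul_ne_zero (Real.exp_pos _).ne' hy.1) hy.2

/-! ### Biorthogonal polynomials -/

/-- A bilinear form on polynomials for which every nonzero polynomial pairs nontrivially with one of
at most the same degree has monic left orthogonal polynomials. -/
theorem exists_monic_orthogonal (b : ℝ[X] →ₗ[ℝ] ℝ[X] →ₗ[ℝ] ℝ)
    (hb : ∀ f ≠ 0, ∃ g : ℝ[X], g.natDegree ≤ f.natDegree ∧ b f g ≠ 0) (n : ℕ) :
    ∃ p : ℝ[X], p.Monic ∧ p.natDegree = n ∧ ∀ g : ℝ[X], g.degree < n → b p g = 0 := by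
  let φ : degreeLT ℝ n →ₗ[ℝ] Module.Dual ℝ (degreeLT ℝ n) :=
    b.compl₁₂ (degreeLT ℝ n).subtype (degreeLT ℝ n).subtype
  have : Module.Finite ℝ (degreeLT ℝ n) := Module.Finite.equiv (degreeLTEquiv ℝ n).symm
  have hinj : Function.Injective φ := by
    rw [← LinearMap.ker_eq_bot, LinearMap.ker_eq_bot']
    intro f hf
    by_contra hf0
    have hf0' : (f : ℝ[X]) ≠ 0 := fun h => hf0 (Subtype.ext h)
    obtain ⟨g, hgd, hg⟩ := hb f hf0'
    have hgn : g ∈ degreeLT ℝ n := by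
      rw [mem_degreeLT]
      exact (degree_le_natDegree.trans (by exact_mod_cast hgd)).trans_lt
        ((degree_eq_natDegree hf0').symm.trans_lt (mem_degreeLT.1 f.2))
    exact hg (LinearMap.congr_fun hf ⟨g, hgn⟩)
  have hsurj : Function.Surjective φ :=
    (LinearMap.injective_iff_surjective_of_finrank_eq_finrank
      (Subspace.dual_finrank_eq (K := ℝ) (V := degreeLT ℝ n)).symm).1 hinj
  obtain ⟨f, hf⟩ := hsurj (-(b (X ^ n) ∘ₗ (degreeLT ℝ n).subtype))
  have hfd := mem_degreeLT.1 f.2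
  have hm : (X ^ n + (f : ℝ[X])).Monic := monic_X_pow_add hfd
  have hd : (X ^ n + (f : ℝ[X])).natDegree = n := by
    refine natDegree_eq_of_degree_eq_some ?_
    rw [degree_add_eq_left_of_degree_lt (by rwa [degree_X_pow]), degree_X_pow]
  refine ⟨X ^ n + (f : ℝ[X]), hm, hd, fun g hg => ?_⟩
  have h1 := LinearMap.congr_fun hf ⟨g, mem_degreeLT.2 hg⟩
  have h2 : b f g = -b (X ^ n) g := h1
  rw [map_add, LinearMap.add_apply, h2]
  ring

/-- Subtracting a multiple of a monic polynomial of degree `m` removes the coefficient of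
`X ^ m`. -/
theorem degree_sub_C_mul_lt {g q : ℝ[X]} {m : ℕ} (hq : q.Monic) (hqd : q.natDegree = m)
    (hg : g.degree < (m + 1 : ℕ)) : (g - C (g.coeff m) * q).degree < m := by
  rw [degree_lt_iff_coeff_zero] at hg ⊢
  intro k hk
  rcases hk.eq_or_lt with rfl | hk
  · have h1 : q.coeff m = 1 := by rw [← hqd]; exact hq
    simp [h1]
  · simp [hg k hk, coeff_eq_zero_of_natDegree_lt (hqd.trans_lt hk)]

/-- Monic polynomials of degrees `0, …, m - 1` span the polynomials of degree less than `m`. -/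
theorem orthogonal_of_degree_lt {b : ℝ[X] →ₗ[ℝ] ℝ} {q : ℕ → ℝ[X]} (hq : ∀ j, (q j).Monic)
    (hqd : ∀ j, (q j).natDegree = j) (m : ℕ) (hb : ∀ j < m, b (q j) = 0) :
    ∀ g : ℝ[X], g.degree < m → b g = 0 := by
  induction m with
  | zero =>
    intro g hg
    rw [show g = 0 by simpa using hg, map_zero]
  | succ m ih =>
    intro g hg
    have h1 := ih (fun j hj => hb j (by omega)) _ (degree_sub_C_mul_lt (hq m) (hqd m) hg)
    rw [map_sub, ← smul_eq_C_mul, map_smul, hb m (by omega), smul_zero, sub_zero] at h1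
    exact h1

theorem IsBiorthogonal.swap {p q : ℕ → ℝ[X]} (h : IsBiorthogonal V W τ p q) :
    IsBiorthogonal W V τ q p where
  monic_left := h.monic_right
  natDegree_left := h.natDegree_right
  monic_right := h.monic_left
  natDegree_right := h.natDegree_left
  orthogonal i j hij := by rw [pairing_swap]; exact h.orthogonal j i hij.symm

theorem GaussianBound.exists_isBiorthogonal (h : GaussianBound V W τ ε B) (hε : 0 < ε)
    (hτ : τ ≠ 0) : ∃ p q : ℕ → ℝ[X], IsBiorthogonal V W τ p q := by
  choose p hp hpd hpo using exists_monic_orthogonal (h.pairingForm hε)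
    fun f hf => h.exists_pairing_ne_zero hε hτ hf
  choose q hq hqd hqo using exists_monic_orthogonal (h.swap.pairingForm hε)
    fun f hf => h.swap.exists_pairing_ne_zero hε hτ hf
  refine ⟨p, q, hp, hpd, hq, hqd, fun i j hij => ?_⟩
  rcases lt_or_gt_of_ne hij with hlt | hlt
  · rw [pairing_swap]
    refine hqo j (p i) ?_
    rw [degree_eq_natDegree (hp i).ne_zero, hpd]; exact_mod_cast hlt
  · refine hpo i (q j) ?_
    rw [degree_eq_natDegree (hq j).ne_zero, hqd]; exact_mod_cast hlt

theorem IsBiorthogonal.pairing_eq_zero {p q : ℕ → ℝ[X]} (hpq : IsBiorthogonal V W τ p q)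
    (h : GaussianBound V W τ ε B) (hε : 0 < ε) (i : ℕ) {g : ℝ[X]} (hg : g.degree < i) :
    pairing V W τ (p i) g = 0 :=
  orthogonal_of_degree_lt (b := h.pairingForm hε (p i)) hpq.monic_right hpq.natDegree_right i
    (fun j hj => hpq.orthogonal i j (by omega)) g hg

/-- Two candidates for `p_i` differ by a polynomial of degree less than `i` which is orthogonal to
all such polynomials. -/
theorem IsBiorthogonal.left_unique {p q p' q' : ℕ → ℝ[X]} (hpq : IsBiorthogonal V W τ p q)
    (hpq' : IsBiorthogonal V W τ p' q') (h : GaussianBound V W τ ε B) (hε : 0 < ε) (hτ : τ ≠ 0) :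
    p = p' := by
  funext i
  by_contra hne
  obtain ⟨g, hgd, hg⟩ := h.exists_pairing_ne_zero hε hτ (sub_ne_zero.2 hne)
  have hd : (p i - p' i).degree < i := by
    have h1 := degree_sub_lt_left (p := p i) (q := p' i)
      (by rw [degree_eq_natDegree (hpq.monic_left i).ne_zero,
        degree_eq_natDegree (hpq'.monic_left i).ne_zero, hpq.natDegree_left, hpq'.natDegree_left])
      (hpq.monic_left i).ne_zero (by rw [hpq.monic_left i, hpq'.monic_left i])
    rwa [degree_eq_natDegree (hpq.monic_left i).ne_zero, hpq.natDegree_left] at h1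
  have hgi : g.degree < i := by
    rw [degree_eq_natDegree (sub_ne_zero.2 hne)] at hd
    exact degree_le_natDegree.trans_lt ((Nat.cast_le.2 hgd).trans_lt hd)
  apply hg
  rw [← h.pairingForm_apply hε, map_sub, LinearMap.sub_apply, h.pairingForm_apply,
    h.pairingForm_apply, hpq.pairing_eq_zero h hε i hgi, hpq'.pairing_eq_zero h hε i hgi, sub_zero]

/-- If `h_i² = 0`, then `p_i` is orthogonal to all polynomials of degree at most `i`. -/
theorem IsBiorthogonal.hSq_ne_zero {p q : ℕ → ℝ[X]} (hpq : IsBiorthogonal V W τ p q)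
    (h : GaussianBound V W τ ε B) (hε : 0 < ε) (hτ : τ ≠ 0) (i : ℕ) :
    hSq V W τ p q i ≠ 0 := by
  intro h0
  obtain ⟨g, hgd, hg⟩ := h.exists_pairing_ne_zero hε hτ (hpq.monic_left i).ne_zero
  refine hg (orthogonal_of_degree_lt (b := h.pairingForm hε (p i)) hpq.monic_right
    hpq.natDegree_right (i + 1) (fun j hj => ?_) g ?_)
  · rcases (Nat.lt_succ_iff.1 hj).eq_or_lt with rfl | hj
    · exact h0
    · exact hpq.orthogonal i j (by omega)
  · rw [hpq.natDegree_left] at hgd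
    exact degree_le_natDegree.trans_lt (by exact_mod_cast Nat.lt_succ_of_le hgd)

theorem GaussianBound.existsUnique_isBiorthogonal (h : GaussianBound V W τ ε B) (hε : 0 < ε)
    (hτ : τ ≠ 0) :
    ∃! pq : (ℕ → ℝ[X]) × (ℕ → ℝ[X]), IsBiorthogonal V W τ pq.1 pq.2 := by
  obtain ⟨p, q, hpq⟩ := h.exists_isBiorthogonal hε hτ
  refine ⟨(p, q), hpq, fun pq' h' => Prod.ext ?_ ?_⟩
  · exact h'.left_unique hpq h hε hτ
  · exact h'.swap.left_unique hpq.swap h.swap hε hτ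

section KernelDet

/-! ### Integrating out points of a determinantal kernel -/

/-- The determinant of a bordered matrix. For an arbitrary corner block `M` the identity is obtained
from the one for `X + M`, whose determinant is a monic polynomial and hence cancellable. -/
theorem det_bordered {R ι : Type*} [CommRing R] [Fintype ι] [DecidableEq ι] (M : Matrix ι ι R)
    (u v : ι → R) (d : R) :
    (Matrix.fromBlocks M (Matrix.replicateCol Unit u) (Matrix.replicateRow Unit v)
      (Matrix.of fun _ _ => d)).det = d * M.det - ∑ i, ∑ j, u i * v j * M.adjugate j i := by
  -- Multiplication by a block upper triangular matrix clears the last column.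
  have cancel : ∀ {A : Type _} [CommRing A] (M : Matrix ι ι A) (u v : ι → A) (d : A),
      (Matrix.fromBlocks M (Matrix.replicateCol Unit u) (Matrix.replicateRow Unit v)
        (Matrix.of fun _ _ => d)).det * M.det =
      (d * M.det - ∑ i, ∑ j, u i * v j * M.adjugate j i) * M.det := by
    intro A _ M u v d
    have h1 : Matrix.fromBlocks M (Matrix.replicateCol Unit u) (Matrix.replicateRow Unit v)
          (Matrix.of fun _ _ => d) *
        Matrix.fromBlocks 1 (Matrix.replicateCol Unit (-(M.adjugate.mulVec u))) 0
          (Matrix.of fun _ _ => M.det) =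
        Matrix.fromBlocks M 0 (Matrix.replicateRow Unit v)
          (Matrix.of fun _ _ => d * M.det - ∑ i, ∑ j, u i * v j * M.adjugate j i) := by
      rw [Matrix.fromBlocks_multiply]
      congr 1
      · simp
      · ext i k
        have h2 : (M.mulVec (M.adjugate.mulVec u)) i = M.det * u i := by
          rw [Matrix.mulVec_mulVec, Matrix.mul_adjugate, Matrix.smul_mulVec, Matrix.one_mulVec]; rfl
        rw [Matrix.add_apply, Matrix.mul_apply, Matrix.mul_apply]
        simp only [Matrix.replicateCol_apply, Pi.neg_apply, mul_neg, Finset.sum_neg_distrib,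
          Matrix.of_apply, Finset.univ_unique, Finset.sum_singleton, Matrix.zero_apply]
        have h3 : ∑ j, M i j * (M.adjugate.mulVec u) j = M.det * u i := h2
        rw [h3]; ring
      · simp
      · ext i k
        rw [Matrix.add_apply, Matrix.mul_apply, Matrix.mul_apply]
        simp only [Matrix.replicateCol_apply, Matrix.replicateRow_apply, Pi.neg_apply, mul_neg,
          Finset.sum_neg_distrib, Matrix.of_apply, Finset.univ_unique, Finset.sum_singleton,
          Matrix.mulVec, dotProduct, Finset.mul_sum]
        rw [Finset.sum_comm, neg_add_eq_sub]
        congr 1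
        exact Finset.sum_congr rfl fun _ _ => Finset.sum_congr rfl fun _ _ => by ring
    have h4 := congrArg Matrix.det h1
    rw [Matrix.det_mul, Matrix.det_fromBlocks_zero₂₁, Matrix.det_fromBlocks_zero₁₂] at h4
    simp only [Matrix.det_one, one_mul, Matrix.det_unique, Matrix.of_apply] at h4
    rw [h4]; ring
  have hpoly := cancel (Matrix.charmatrix (-M)) (fun i => C (u i)) (fun i => C (v i)) (C d)
  have hreg := (Matrix.charpoly_monic (-M)).isRegular.right
  have hpoly' := hreg hpoly
  have hM : (Matrix.charmatrix (-M)).map (evalRingHom (0 : R)) = M := by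
    ext i j
    by_cases hij : i = j
    · subst hij; simp
    · simp [Matrix.charmatrix_apply_ne _ _ _ hij]
  have h5 := congrArg (evalRingHom (0 : R)) hpoly'
  rw [RingHom.map_det, map_sub, map_mul, RingHom.map_det, map_sum] at h5
  simp only [map_sum, map_mul, RingHom.mapMatrix_apply, hM] at h5
  have hadj : ∀ i j, evalRingHom (0 : R) ((Matrix.charmatrix (-M)).adjugate i j)
      = M.adjugate i j := fun i j => by
    have := RingHom.map_adjugate (evalRingHom (0 : R)) (Matrix.charmatrix (-M))
    rw [RingHom.mapMatrix_apply, RingHom.mapMatrix_apply, hM] at this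
    exact congrFun (congrFun this i) j
  simp only [hadj] at h5
  simp only [coe_evalRingHom, eval_C] at h5
  rw [← h5]
  congr 1
  rw [Matrix.fromBlocks_map, ← coe_evalRingHom, hM]
  congr 1 <;> ext <;> simp

variable {S : Type*}

/-- The determinant of the matrix of values of a kernel at a finite family of points. -/
def kernelDet (K : S → S → ℝ) {ι : Type} [Fintype ι] [DecidableEq ι] (z : ι → S) : ℝ :=
  (Matrix.of fun i j => K (z i) (z j)).det

theorem kernelDet_comp_equiv (K : S → S → ℝ) {ι κ : Type} [Fintype ι] [DecidableEq ι] [Fintype κ]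
    [DecidableEq κ] (e : ι ≃ κ) (z : κ → S) : kernelDet K (z ∘ e) = kernelDet K z :=
  Matrix.det_submatrix_equiv_self e (Matrix.of fun i j => K (z i) (z j))

theorem kernelDet_flip (K : S → S → ℝ) {ι : Type} [Fintype ι] [DecidableEq ι] (z : ι → S) :
    kernelDet (fun a b => K b a) z = kernelDet K z :=
  Matrix.det_transpose (Matrix.of fun i j => K (z i) (z j))

theorem kernelDet_insert (K : S → S → ℝ) {ι : Type} [Fintype ι] [DecidableEq ι] (z : ι → S)
    (a : S) :
    kernelDet K (Sum.elim z fun _ : Unit => a) = K a a * kernelDet K z -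
      ∑ i, ∑ j, K (z i) a * K a (z j) * (Matrix.of fun i j => K (z i) (z j)).adjugate j i := by
  rw [kernelDet, kernelDet, ← det_bordered]
  congr 1
  ext i j
  rcases i with i | i <;> rcases j with j | j <;> simp

variable {X : Type*} [MeasureSpace X]

/-- Integrating out one point of a determinant built from a kernel which reproduces itself from the
left at the points with `c = 1` and annihilates itself at the points with `c = 0`. -/
theorem integral_kernelDet_insert {K : S → S → ℝ} {e : X → S} {c : S → ℝ} {N : ℝ}
    (hi0 : Integrable fun x => K (e x) (e x)) (htr : ∫ x, K (e x) (e x) = N)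
    (hi : ∀ a b, Integrable fun x => K a (e x) * K (e x) b)
    (hrep : ∀ a b, ∫ x, K a (e x) * K (e x) b = c a * K a b)
    {ι : Type} [Fintype ι] [DecidableEq ι] (z : ι → S) :
    ∫ x, kernelDet K (Sum.elim z fun _ : Unit => e x) = (N - ∑ i, c (z i)) * kernelDet K z := by
  simp only [kernelDet_insert]
  set M : Matrix ι ι ℝ := Matrix.of fun i j => K (z i) (z j) with hM
  have hi1 : ∀ i j, Integrable fun x => K (z i) (e x) * K (e x) (z j) * M.adjugate j i :=
    fun i j => (hi _ _).mul_const _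
  rw [integral_sub (hi0.mul_const _)
    (integrable_finsetSum _ fun i _ => integrable_finsetSum _ fun j _ => hi1 i j),
    integral_mul_const, htr, integral_finsetSum _ fun i _ =>
      integrable_finsetSum _ fun j _ => hi1 i j]
  rw [sub_mul, Finset.sum_mul]
  congr 1
  refine Finset.sum_congr rfl fun i _ => ?_
  rw [integral_finsetSum _ fun j _ => hi1 i j]
  have h1 : ∑ j, M i j * M.adjugate j i = M.det := by
    rw [← Matrix.mul_apply, Matrix.mul_adjugate]; simp
  rw [kernelDet, ← hM, ← h1, Finset.mul_sum]
  refine Finset.sum_congr rfl fun j _ => ?_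
  rw [integral_mul_const, hrep, hM, Matrix.of_apply]; ring

/-- Integrating out `k` points, one after the other: each point that is present reduces the factor
contributed by the next one to be integrated out. -/
theorem integral_kernelDet [SigmaFinite (volume : Measure X)]
    {K : S → S → ℝ} {e : X → S} {c : S → ℝ} {N : ℝ}
    (hi0 : Integrable fun x => K (e x) (e x)) (htr : ∫ x, K (e x) (e x) = N)
    (hi : ∀ a b, Integrable fun x => K a (e x) * K (e x) b)
    (hrep : ∀ a b, ∫ x, K a (e x) * K (e x) b = c a * K a b)
    (hc : ∀ x, c (e x) = 1)
    (hint : ∀ {ι : Type} [Fintype ι] [DecidableEq ι] (z : ι → S) (k : ℕ),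
      Integrable fun s : Fin k → X => kernelDet K (Sum.elim z (e ∘ s))) (k : ℕ) :
    ∀ {ι : Type} [Fintype ι] [DecidableEq ι] (z : ι → S),
    ∫ s : Fin k → X, kernelDet K (Sum.elim z (e ∘ s)) =
      (∏ j ∈ Finset.range k, (N - ∑ i, c (z i) - j)) * kernelDet K z := by
  induction k with
  | zero =>
    intro ι _ _ z
    have h1 : ∀ s : Fin 0 → X, kernelDet K (Sum.elim z (e ∘ s)) = kernelDet K z := fun s => by
      rw [← kernelDet_comp_equiv K (Equiv.sumEmpty ι (Fin 0)) z]
      congr 1; ext i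
      rcases i with i | i
      · rfl
      · exact i.elim0
    simp [h1, Measure.volume_pi_eq_dirac (fun i : Fin 0 => i.elim0)]
  | succ k ih =>
    intro ι _ _ z
    have h1 : ∀ x : X, ∀ s : Fin k → X,
        kernelDet K (Sum.elim z (e ∘ Fin.cons (α := fun _ => X) x s)) =
        kernelDet K (Sum.elim (Sum.elim z fun _ : Unit => e x) (e ∘ s)) := fun x s => by
      rw [← kernelDet_comp_equiv K (((Equiv.sumAssoc ι Unit (Fin k)).trans
        (Equiv.sumCongr (Equiv.refl ι) ((Equiv.sumComm Unit (Fin k)).trans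
          ((Equiv.optionEquivSumPUnit (Fin k)).symm.trans (finSuccEquiv k).symm)))))
        (Sum.elim z (e ∘ Fin.cons (α := fun _ => X) x s))]
      congr 1; ext i
      rcases i with (i | i) | i <;> simp
    have hmp := (volume_preserving_piFinSuccAbove (fun _ : Fin (k + 1) => X) 0).symm
    rw [← hmp.integral_comp' (g := fun s => kernelDet K (Sum.elim z (e ∘ s)))]
    have hi' := (hmp.integrable_comp_emb (MeasurableEquiv.measurableEmbedding _)).2 (hint z (k + 1))
    have h2 : ∀ w : X × (Fin k → X),
        (MeasurableEquiv.piFinSuccAbove (fun _ : Fin (k + 1) => X) 0).symm w =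
          Fin.cons (α := fun _ => X) w.1 w.2 := fun w => by
      simp [MeasurableEquiv.piFinSuccAbove, Fin.insertNthEquiv]
    simp only [Function.comp_def] at hi'
    simp only [h2] at hi' ⊢
    simp only [Function.comp_def] at h1 hi' ⊢
    simp only [h1] at hi' ⊢
    rw [Measure.volume_eq_prod] at hi' ⊢
    rw [integral_prod _ hi']
    have h3 : ∀ x, ∫ s : Fin k → X,
        kernelDet K (Sum.elim (Sum.elim z fun _ : Unit => e x) (fun i => e (s i))) =
        (∏ j ∈ Finset.range k, (N - ∑ i, c (z i) - (j + 1 : ℕ))) *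
          kernelDet K (Sum.elim z fun _ : Unit => e x) := fun x => by
      rw [show (fun s : Fin k → X => kernelDet K (Sum.elim (Sum.elim z fun _ : Unit => e x)
        (fun i => e (s i)))) = fun s => kernelDet K (Sum.elim (Sum.elim z fun _ : Unit => e x)
        (e ∘ s)) from rfl, ih]
      congr 1
      refine Finset.prod_congr rfl fun j _ => ?_
      rw [Fintype.sum_sum_type]
      simp [hc]; ring
    simp only [h3]
    rw [integral_const_mul, integral_kernelDet_insert hi0 htr hi hrep, Finset.prod_range_succ']
    simp; ring

/-! ### Integrability of determinants of dominated kernels -/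

/-- In each term of the determinant every point occurs once as a row and once as a column. -/
theorem abs_kernelDet_le {K : S → S → ℝ} {α β : S → ℝ}
    (hK : ∀ a b, |K a b| ≤ α a * β b) {ι : Type} [Fintype ι] [DecidableEq ι] (z : ι → S) :
    |kernelDet K z| ≤ (Fintype.card ι).factorial * ∏ i, α (z i) * β (z i) := by
  rw [kernelDet, Matrix.det_apply']
  refine (Finset.abs_sum_le_sum_abs _ _).trans ?_
  have h1 : ∀ σ : Equiv.Perm ι, |((Equiv.Perm.sign σ : ℤ) : ℝ) *
      ∏ i, (Matrix.of fun i j => K (z i) (z j)) (σ i) i| ≤ ∏ i, α (z i) * β (z i) := by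
    intro σ
    have h2 : |((Equiv.Perm.sign σ : ℤ) : ℝ)| = 1 := by
      rcases Int.units_eq_one_or (Equiv.Perm.sign σ) with h | h <;> simp [h]
    rw [abs_mul, h2, one_mul, Finset.abs_prod]
    calc ∏ i, |(Matrix.of fun i j => K (z i) (z j)) (σ i) i|
        ≤ ∏ i, α (z (σ i)) * β (z i) :=
          Finset.prod_le_prod (fun _ _ => abs_nonneg _) fun i _ => hK _ _
      _ = ∏ i, α (z i) * β (z i) := by
          rw [Finset.prod_mul_distrib, Finset.prod_mul_distrib,
            Equiv.prod_comp σ fun i => α (z i)]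
  refine (Finset.sum_le_card_nsmul _ _ _ fun σ _ => h1 σ).trans ?_
  rw [Finset.card_univ, Fintype.card_perm, nsmul_eq_mul]

theorem measurable_kernelDet [MeasurableSpace S] {Ω : Type*} [MeasurableSpace Ω] {K : S → S → ℝ}
    (hK : Measurable fun w : S × S => K w.1 w.2) {ι : Type} [Fintype ι] [DecidableEq ι]
    {z : Ω → ι → S} (hz : ∀ i, Measurable fun ω => z ω i) :
    Measurable fun ω => kernelDet K (z ω) := by
  simp only [kernelDet, Matrix.det_apply', Matrix.of_apply]
  refine Finset.measurable_sum _ fun σ _ => (Finset.measurable_prod _ fun i _ => ?_).const_mul _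
  exact hK.comp ((hz (σ i)).prodMk (hz i))

variable [SigmaFinite (volume : Measure X)] [MeasurableSpace S]

theorem integrable_kernelDet {K : S → S → ℝ} (hK : Measurable fun w : S × S => K w.1 w.2)
    {α β : S → ℝ} (hab : ∀ a b, |K a b| ≤ α a * β b) {e : X → S} (he : Measurable e)
    (hi : Integrable fun x => α (e x) * β (e x)) {ι : Type} [Fintype ι] [DecidableEq ι]
    (z : ι → S) (k : ℕ) :
    Integrable fun s : Fin k → X => kernelDet K (Sum.elim z (e ∘ s)) := by
  have h1 : Integrable fun s : Fin k → X => ∏ i, α (e (s i)) * β (e (s i)) :=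
    Integrable.fintype_prod (f := fun _ x => α (e x) * β (e x)) fun _ => hi
  refine (h1.const_mul ((Fintype.card (ι ⊕ Fin k)).factorial *
    ∏ i, α (z i) * β (z i))).mono' (measurable_kernelDet hK ?_).aestronglyMeasurable
    (Filter.Eventually.of_forall fun s => ?_)
  · rintro (i | i)
    · exact measurable_const
    · exact he.comp (measurable_pi_apply i)
  · refine (abs_kernelDet_le hab _).trans (le_of_eq ?_)
    rw [Fintype.prod_sum_type, ← mul_assoc]
    rfl

theorem integrable_kernelDet_prod {Y : Type*} [MeasureSpace Y] [SigmaFinite (volume : Measure Y)]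
    {K : S → S → ℝ} (hK : Measurable fun w : S × S => K w.1 w.2)
    {α β : S → ℝ} (hab : ∀ a b, |K a b| ≤ α a * β b)
    {e : X → S} (he : Measurable e) (hi : Integrable fun x => α (e x) * β (e x))
    {e' : Y → S} (he' : Measurable e') (hi' : Integrable fun y => α (e' y) * β (e' y))
    {ι : Type} [Fintype ι] [DecidableEq ι] (z : ι → S) (k k' : ℕ) :
    Integrable fun w : (Fin k → X) × (Fin k' → Y) =>
      kernelDet K (Sum.elim (Sum.elim z (e ∘ w.1)) (e' ∘ w.2)) := by
  have h1 : Integrable fun s : Fin k → X => ∏ i, α (e (s i)) * β (e (s i)) :=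
    Integrable.fintype_prod (f := fun _ x => α (e x) * β (e x)) fun _ => hi
  have h2 : Integrable fun s : Fin k' → Y => ∏ i, α (e' (s i)) * β (e' (s i)) :=
    Integrable.fintype_prod (f := fun _ x => α (e' x) * β (e' x)) fun _ => hi'
  refine ((h1.mul_prod h2).const_mul ((Fintype.card ((ι ⊕ Fin k) ⊕ Fin k')).factorial *
    ∏ i, α (z i) * β (z i))).mono' (measurable_kernelDet hK ?_).aestronglyMeasurable
    (Filter.Eventually.of_forall fun s => ?_)
  · rintro ((i | i) | i)
    · exact measurable_const
    · exact he.comp ((measurable_pi_apply i).comp measurable_fst)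
    · exact he'.comp ((measurable_pi_apply i).comp measurable_snd)
  · refine (abs_kernelDet_le hab _).trans (le_of_eq ?_)
    rw [Fintype.prod_sum_type, Fintype.prod_sum_type, mul_assoc, mul_assoc]
    rfl

end KernelDet

variable {p q : ℕ → ℝ[X]}

/-! ### The Eynard-Mehta kernels as one kernel on two copies of the line -/

/-- The functions `p_i` on the first copy of the line and `P_i` on the second. -/
def leftFun (V W : ℝ[X]) (τ : ℝ) (p : ℕ → ℝ[X]) (i : ℕ) : ℝ ⊕ ℝ → ℝ :=
  Sum.elim (fun x => (p i).eval x) (transP V W τ p i)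

/-- The functions `Q_i` on the first copy of the line and `q_i` on the second. -/
def rightFun (V W : ℝ[X]) (τ : ℝ) (q : ℕ → ℝ[X]) (i : ℕ) : ℝ ⊕ ℝ → ℝ :=
  Sum.elim (transQ V W τ q i) (fun y => (q i).eval y)

/-- The weight, as a kernel from the second copy of the line to the first, extended by zero. -/
def jump (V W : ℝ[X]) (τ : ℝ) : ℝ ⊕ ℝ → ℝ ⊕ ℝ → ℝ
  | .inr y, .inl x => weight V W τ x y
  | _, _ => 0

/-- The four Eynard-Mehta kernels combined into one kernel on the disjoint union of the line of
eigenvalues of the first matrix and the line of eigenvalues of the second. -/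
def emKernel (V W : ℝ[X]) (τ : ℝ) (p q : ℕ → ℝ[X]) (n : ℕ) (a b : ℝ ⊕ ℝ) : ℝ :=
  (∑ i ∈ Finset.range n, 1 / hSq V W τ p q i * leftFun V W τ p i a * rightFun V W τ q i b)
    - jump V W τ a b

theorem det_kernelMatrix (n : ℕ) {I J : ℕ} (l : Fin I → ℝ) (m : Fin J → ℝ) :
    (kernelMatrix V W τ p q n l m).det =
      kernelDet (emKernel V W τ p q n) (Sum.elim (Sum.inl ∘ l) (Sum.inr ∘ m)) := by
  rw [kernelDet]
  congr 1
  ext i j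
  rcases i with i | i <;> rcases j with j | j <;>
    simp [kernelMatrix, emKernel, leftFun, rightFun, jump, K11, K12, K21, K22]

theorem hSq_swap (i : ℕ) : hSq W V τ q p i = hSq V W τ p q i := pairing_swap W V τ (q i) (p i)

theorem transP_swap (i : ℕ) : transP W V τ q i = transQ V W τ q i := by
  ext x; rw [transP_eq_transform, transQ_eq_transform]

theorem transQ_swap (i : ℕ) : transQ W V τ p i = transP V W τ p i := (transP_swap i).symm

/-- Exchanging the roles of the two matrices transposes the kernel. -/
theorem emKernel_swap (n : ℕ) (a b : ℝ ⊕ ℝ) :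
    emKernel W V τ q p n a.swap b.swap = emKernel V W τ p q n b a := by
  have h1 : ∀ i, leftFun W V τ q i a.swap = rightFun V W τ q i a := fun i => by
    rcases a with a | a <;> simp [leftFun, rightFun, transP_swap]
  have h2 : ∀ i, rightFun W V τ p i b.swap = leftFun V W τ p i b := fun i => by
    rcases b with b | b <;> simp [leftFun, rightFun, transQ_swap]
  have h3 : jump W V τ a.swap b.swap = jump V W τ b a := by
    rcases a with a | a <;> rcases b with b | b <;> simp [jump, weight_swap V W]
  simp only [emKernel, h1, h2, h3, hSq_swap]
  congr 1
  exact Finset.sum_congr rfl fun i _ => by ring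

theorem measurable_emKernel (h : GaussianBound V W τ ε B) (hε : 0 < ε) (n : ℕ) :
    Measurable fun w : (ℝ ⊕ ℝ) × (ℝ ⊕ ℝ) => emKernel V W τ p q n w.1 w.2 := by
  have hP : ∀ i, Measurable (transP V W τ p i) := fun i =>
    (h.continuous_transform hε (p i)).measurable
  have hQ : ∀ i, Measurable (transQ V W τ q i) := fun i => by
    rw [← transP_swap]; exact (h.swap.continuous_transform hε (q i)).measurable
  have h1 : ∀ i, Measurable (leftFun V W τ p i) := fun i =>
    (p i).continuous.measurable.sumElim (hP i)
  have h2 : ∀ i, Measurable (rightFun V W τ q i) := fun i =>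
    (hQ i).sumElim (q i).continuous.measurable
  have hval : Measurable (Sum.elim id id : ℝ ⊕ ℝ → ℝ) := measurable_id.sumElim measurable_id
  have hl : Measurable (Sum.elim (fun _ => 1) (fun _ => 0) : ℝ ⊕ ℝ → ℝ) :=
    measurable_const.sumElim measurable_const
  have hr : Measurable (Sum.elim (fun _ => 0) (fun _ => 1) : ℝ ⊕ ℝ → ℝ) :=
    measurable_const.sumElim measurable_const
  have h3 : Measurable fun w : (ℝ ⊕ ℝ) × (ℝ ⊕ ℝ) => jump V W τ w.1 w.2 := by
    have heq : (fun w : (ℝ ⊕ ℝ) × (ℝ ⊕ ℝ) => jump V W τ w.1 w.2) = fun w =>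
        Sum.elim (fun _ => 0) (fun _ => 1) w.1 * Sum.elim (fun _ => 1) (fun _ => 0) w.2 *
          weight V W τ (Sum.elim id id w.2) (Sum.elim id id w.1) := by
      ext ⟨a, b⟩
      rcases a with a | a <;> rcases b with b | b <;> simp [jump]
    rw [heq]
    exact ((hr.comp measurable_fst).mul (hl.comp measurable_snd)).mul
      ((continuous_weight V W τ).measurable.comp
        ((hval.comp measurable_snd).prodMk (hval.comp measurable_fst)))
  refine Measurable.sub (Finset.measurable_sum _ fun i _ => ?_) h3
  exact (((h1 i).comp measurable_fst).const_mul _).mul ((h2 i).comp measurable_snd)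

/-- The kernel is dominated by a product `α(a) β(b)` in which `α β` is a Gaussian on each line: the
growth of the polynomials is absorbed by half of the decay of the transforms. -/
theorem exists_abs_emKernel_le (h : GaussianBound V W τ ε B) (hε : 0 < ε) (n : ℕ) :
    ∃ α β : ℝ ⊕ ℝ → ℝ, (∀ a b, |emKernel V W τ p q n a b| ≤ α a * β b) ∧
      (Integrable fun x : ℝ => α (Sum.inl x) * β (Sum.inl x)) ∧
      (Integrable fun y : ℝ => α (Sum.inr y) * β (Sum.inr y)) := by
  set α : ℝ ⊕ ℝ → ℝ := Sum.elim (fun x => Real.exp (ε / 2 * x ^ 2)) (fun y => Real.exp (-ε * y ^ 2))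
    with hα
  set β : ℝ ⊕ ℝ → ℝ := Sum.elim (fun x => Real.exp (-ε * x ^ 2)) (fun y => Real.exp (ε / 2 * y ^ 2))
    with hβ
  have hα0 : ∀ a, 0 < α a := by rintro (a | a) <;> exact Real.exp_pos _
  have hβ0 : ∀ a, 0 < β a := by rintro (a | a) <;> exact Real.exp_pos _
  have h1 : ∀ i, ∃ A, 0 < A ∧ ∀ a, |leftFun V W τ p i a| ≤ A * α a := fun i => by
    obtain ⟨A, hA, h1⟩ := exists_abs_eval_le_exp (p i) (half_pos hε)
    obtain ⟨A', hA', h2⟩ := h.exists_abs_transform_le hε (p i)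
    refine ⟨max A A', by positivity, ?_⟩
    rintro (a | a)
    · exact (h1 a).trans (mul_le_mul_of_nonneg_right (le_max_left _ _) (hα0 (.inl a)).le)
    · exact (h2 a).trans (mul_le_mul_of_nonneg_right (le_max_right _ _) (hα0 (.inr a)).le)
  have h2 : ∀ i, ∃ A, 0 < A ∧ ∀ a, |rightFun V W τ q i a| ≤ A * β a := fun i => by
    obtain ⟨A, hA, h1⟩ := exists_abs_eval_le_exp (q i) (half_pos hε)
    obtain ⟨A', hA', h2⟩ := h.swap.exists_abs_transform_le hε (q i)
    refine ⟨max A A', by positivity, ?_⟩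
    rintro (a | a)
    · rw [rightFun, Sum.elim_inl, ← transP_swap]
      exact (h2 a).trans (mul_le_mul_of_nonneg_right (le_max_right _ _) (hβ0 (.inl a)).le)
    · exact (h1 a).trans (mul_le_mul_of_nonneg_right (le_max_left _ _) (hβ0 (.inr a)).le)
  have h3 : ∀ a b, |jump V W τ a b| ≤ B * (α a * β b) := by
    have hB := h.pos
    intro a b
    have h0 := mul_pos (hα0 a) (hβ0 b)
    rcases a with a | a <;> rcases b with b | b
    · simpa [jump] using (mul_pos hB h0).le
    · simpa [jump] using (mul_pos hB h0).le
    · rw [jump, abs_of_pos (weight_pos ..)]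
      refine (h b a).trans (le_of_eq ?_)
      rw [mul_comm (Real.exp _)]; rfl
    · simpa [jump] using (mul_pos hB h0).le
  choose A hA hA' using h1
  choose A₂ hA₂ hA₂' using h2
  set M := (∑ i ∈ Finset.range n, |1 / hSq V W τ p q i| * A i * A₂ i) + B with hM
  refine ⟨fun a => M * α a, β, fun a b => ?_, ?_, ?_⟩
  · rw [emKernel]
    refine (abs_sub _ _).trans ?_
    rw [hM, mul_assoc, add_mul]
    refine add_le_add ((Finset.abs_sum_le_sum_abs _ _).trans ?_) (h3 a b)
    rw [Finset.sum_mul]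
    refine Finset.sum_le_sum fun i _ => ?_
    rw [abs_mul, abs_mul]
    calc |1 / hSq V W τ p q i| * |leftFun V W τ p i a| * |rightFun V W τ q i b|
        ≤ |1 / hSq V W τ p q i| * (A i * α a) * (A₂ i * β b) := by
          have := hA i
          have := hα0 a
          gcongr
          · exact hA' i a
          · exact hA₂' i b
      _ = _ := by ring
  · refine ((integrable_exp_neg_mul_sq (half_pos hε)).const_mul M).congr
      (Filter.Eventually.of_forall fun x => ?_)
    simp only [hα, hβ, Sum.elim_inl]
    rw [mul_assoc, ← Real.exp_add]; congr 2; ring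
  · refine ((integrable_exp_neg_mul_sq (half_pos hε)).const_mul M).congr
      (Filter.Eventually.of_forall fun x => ?_)
    simp only [hα, hβ, Sum.elim_inr]
    rw [mul_assoc, ← Real.exp_add]; congr 2; ring

theorem integrable_rightFun_mul_leftFun (h : GaussianBound V W τ ε B) (hε : 0 < ε) (i j : ℕ) :
    Integrable fun x : ℝ => rightFun V W τ q i (.inl x) * leftFun V W τ p j (.inl x) := by
  simp only [rightFun, leftFun, Sum.elim_inl, ← transP_swap]
  exact h.swap.integrable_transform_mul hε (q i) (p j)

theorem integral_rightFun_mul_leftFun (h : GaussianBound V W τ ε B) (hε : 0 < ε)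
    (hpq : IsBiorthogonal V W τ p q) (i j : ℕ) :
    ∫ x : ℝ, rightFun V W τ q i (.inl x) * leftFun V W τ p j (.inl x) =
      if i = j then hSq V W τ p q j else 0 := by
  simp only [rightFun, leftFun, Sum.elim_inl, ← transP_swap]
  rw [show (∫ x : ℝ, transP W V τ q i x * (p j).eval x) = pairing W V τ (q i) (p j) from
    h.swap.integral_transform_mul hε (q i) (p j), pairing_swap]
  split_ifs with hij
  · rw [hij]; rfl
  · exact hpq.orthogonal j i (Ne.symm hij)

/-- `1` at the eigenvalues of the first matrix, `0` at those of the second. -/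
def isFirst : ℝ ⊕ ℝ → ℝ := Sum.elim (fun _ => 1) (fun _ => 0)

theorem integrable_jump_mul_leftFun (h : GaussianBound V W τ ε B) (hε : 0 < ε) (a : ℝ ⊕ ℝ) (j : ℕ) :
    Integrable fun x : ℝ => jump V W τ a (.inl x) * leftFun V W τ p j (.inl x) := by
  rcases a with a | a
  · simp [jump]
  · simp only [jump, leftFun, Sum.elim_inl]
    exact (h.integrable_eval_mul_weight hε (p j) a).congr
      (Filter.Eventually.of_forall fun x => mul_comm _ _)

theorem integral_jump_mul_leftFun (a : ℝ ⊕ ℝ) (j : ℕ) :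
    ∫ x : ℝ, jump V W τ a (.inl x) * leftFun V W τ p j (.inl x) =
      (1 - isFirst a) * leftFun V W τ p j a := by
  rcases a with a | a
  · simp [jump, isFirst]
  · simp only [jump, leftFun, Sum.elim_inl, isFirst, Sum.elim_inr, sub_zero, one_mul, transP]
    exact integral_congr_ae (Filter.Eventually.of_forall fun x => mul_comm _ _)

theorem emKernel_inl_left (n : ℕ) (x : ℝ) (b : ℝ ⊕ ℝ) : emKernel V W τ p q n (.inl x) b =
    ∑ i ∈ Finset.range n,
      1 / hSq V W τ p q i * leftFun V W τ p i (.inl x) * rightFun V W τ q i b := by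
  rw [emKernel, show jump V W τ (.inl x) b = 0 by rcases b with b | b <;> rfl, sub_zero]

theorem integrable_emKernel_mul_leftFun (h : GaussianBound V W τ ε B) (hε : 0 < ε)
    (n : ℕ) (a : ℝ ⊕ ℝ) (j : ℕ) :
    Integrable fun x : ℝ => emKernel V W τ p q n a (.inl x) * leftFun V W τ p j (.inl x) := by
  simp only [emKernel, sub_mul, Finset.sum_mul, mul_assoc]
  exact (integrable_finsetSum _ fun i _ =>
    ((integrable_rightFun_mul_leftFun h hε i j).const_mul _).const_mul _).sub
      (integrable_jump_mul_leftFun h hε a j)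

theorem integral_emKernel_mul_leftFun (h : GaussianBound V W τ ε B) (hε : 0 < ε)
    (hpq : IsBiorthogonal V W τ p q) (hh : ∀ i, hSq V W τ p q i ≠ 0) {n j : ℕ} (hj : j < n)
    (a : ℝ ⊕ ℝ) :
    ∫ x : ℝ, emKernel V W τ p q n a (.inl x) * leftFun V W τ p j (.inl x) =
      isFirst a * leftFun V W τ p j a := by
  simp only [emKernel, sub_mul, Finset.sum_mul, mul_assoc]
  have hi : ∀ i, Integrable fun x : ℝ => 1 / hSq V W τ p q i * (leftFun V W τ p i a *
      (rightFun V W τ q i (.inl x) * leftFun V W τ p j (.inl x))) := fun i =>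
    ((integrable_rightFun_mul_leftFun h hε i j).const_mul _).const_mul _
  rw [integral_sub (integrable_finsetSum _ fun i _ => hi i) (integrable_jump_mul_leftFun h hε a j),
    integral_finsetSum _ fun i _ => hi i, integral_jump_mul_leftFun]
  simp only [integral_const_mul, integral_rightFun_mul_leftFun h hε hpq]
  rw [Finset.sum_eq_single j (fun i _ hij => by simp [hij])
    (fun hj' => absurd (Finset.mem_range.2 hj) hj')]
  have := hh j
  rw [if_pos rfl]
  field_simp
  ring

/-- Integrated over a point of the first line, the kernel reproduces itself if `a` lies on the first
line; if `a` lies on the second line, the contribution of the jump cancels that of the sum. -/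
theorem integral_emKernel_mul_emKernel (h : GaussianBound V W τ ε B) (hε : 0 < ε)
    (hpq : IsBiorthogonal V W τ p q) (hh : ∀ i, hSq V W τ p q i ≠ 0) (n : ℕ) (a b : ℝ ⊕ ℝ) :
    ∫ x : ℝ, emKernel V W τ p q n a (.inl x) * emKernel V W τ p q n (.inl x) b =
      isFirst a * emKernel V W τ p q n a b := by
  have h1 : ∀ x : ℝ, emKernel V W τ p q n a (.inl x) * emKernel V W τ p q n (.inl x) b =
      ∑ j ∈ Finset.range n, 1 / hSq V W τ p q j * rightFun V W τ q j b *
        (emKernel V W τ p q n a (.inl x) * leftFun V W τ p j (.inl x)) := fun x => by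
    rw [emKernel_inl_left, Finset.mul_sum]
    exact Finset.sum_congr rfl fun j _ => by ring
  simp only [h1]
  rw [integral_finsetSum _ fun j _ => (integrable_emKernel_mul_leftFun h hε n a j).const_mul _]
  simp only [integral_const_mul]
  rw [Finset.sum_congr rfl fun j hj => by
    rw [integral_emKernel_mul_leftFun h hε hpq hh (Finset.mem_range.1 hj) a]]
  rcases a with a | a
  · rw [emKernel_inl_left, Finset.mul_sum]
    exact Finset.sum_congr rfl fun j _ => by ring
  · simp [isFirst]

theorem integral_emKernel_diag (h : GaussianBound V W τ ε B) (hε : 0 < ε)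
    (hpq : IsBiorthogonal V W τ p q) (hh : ∀ i, hSq V W τ p q i ≠ 0) (n : ℕ) :
    ∫ x : ℝ, emKernel V W τ p q n (.inl x) (.inl x) = n := by
  have h1 : ∀ x : ℝ, emKernel V W τ p q n (.inl x) (.inl x) = ∑ j ∈ Finset.range n,
      1 / hSq V W τ p q j * (rightFun V W τ q j (.inl x) * leftFun V W τ p j (.inl x)) :=
    fun x => by
      rw [emKernel_inl_left]
      exact Finset.sum_congr rfl fun j _ => by ring
  simp only [h1]
  rw [integral_finsetSum _ fun j _ => (integrable_rightFun_mul_leftFun h hε j j).const_mul _]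
  simp [integral_const_mul, integral_rightFun_mul_leftFun h hε hpq, hh]

theorem prod_range_sub (k : ℕ) : ∏ j ∈ Finset.range k, ((k : ℝ) - j) = k.factorial := by
  induction k with
  | zero => simp
  | succ k ih =>
    rw [Finset.prod_range_succ', Nat.factorial_succ]
    push_cast
    simp only [add_sub_add_right_eq_sub, ih]
    ring

/-- Integrating out `n - I` eigenvalues of the first matrix. -/
theorem integral_kernelDet_inl (h : GaussianBound V W τ ε B) (hε : 0 < ε)
    (hpq : IsBiorthogonal V W τ p q) (hh : ∀ i, hSq V W τ p q i ≠ 0) {n I : ℕ} (hI : I ≤ n)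
    {ι : Type} [Fintype ι] [DecidableEq ι] (z : ι → ℝ ⊕ ℝ) (hz : ∑ i, isFirst (z i) = I) :
    ∫ s : Fin (n - I) → ℝ, kernelDet (emKernel V W τ p q n) (Sum.elim z (Sum.inl ∘ s)) =
      (n - I).factorial * kernelDet (emKernel V W τ p q n) z := by
  obtain ⟨α, β, hab, hi, -⟩ := exists_abs_emKernel_le (p := p) (q := q) h hε n
  have hm := measurable_emKernel (p := p) (q := q) h hε n
  have hml : Measurable (Sum.inl : ℝ → ℝ ⊕ ℝ) := measurable_inl
  rw [integral_kernelDet (c := isFirst) (N := n) ?_ (integral_emKernel_diag h hε hpq hh n) ?_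
    (integral_emKernel_mul_emKernel h hε hpq hh n) (fun _ => rfl)
    (fun z k => integrable_kernelDet hm hab hml hi z k), hz, ← Nat.cast_sub hI, prod_range_sub]
  · refine hi.mono' (hm.comp (hml.prodMk hml)).aestronglyMeasurable
      (Filter.Eventually.of_forall fun x => hab _ _)
  · intro a b
    refine (hi.const_mul (α a * β b)).mono' ((hm.comp (measurable_const.prodMk hml)).mul
      (hm.comp (hml.prodMk measurable_const))).aestronglyMeasurable
      (Filter.Eventually.of_forall fun x => ?_)
    rw [Real.norm_eq_abs, abs_mul]
    refine (mul_le_mul (hab _ _) (hab _ _) (abs_nonneg _)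
      ((abs_nonneg _).trans (hab _ _))).trans (le_of_eq ?_)
    ring

theorem kernelDet_emKernel_swap (n : ℕ) {ι : Type} [Fintype ι] [DecidableEq ι] (z : ι → ℝ ⊕ ℝ) :
    kernelDet (emKernel W V τ q p n) (fun i => (z i).swap) =
      kernelDet (emKernel V W τ p q n) z := by
  rw [← kernelDet_flip, kernelDet, kernelDet]
  simp only [emKernel_swap]

/-- Integrating out `n - J` eigenvalues of the second matrix. -/
theorem integral_kernelDet_inr (h : GaussianBound V W τ ε B) (hε : 0 < ε)
    (hpq : IsBiorthogonal V W τ p q) (hh : ∀ i, hSq V W τ p q i ≠ 0) {n J : ℕ} (hJ : J ≤ n)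
    {ι : Type} [Fintype ι] [DecidableEq ι] (z : ι → ℝ ⊕ ℝ) (hz : ∑ i, isFirst (z i).swap = J) :
    ∫ s : Fin (n - J) → ℝ, kernelDet (emKernel V W τ p q n) (Sum.elim z (Sum.inr ∘ s)) =
      (n - J).factorial * kernelDet (emKernel V W τ p q n) z := by
  have h1 := integral_kernelDet_inl h.swap hε hpq.swap (fun i => by rw [hSq_swap]; exact hh i) hJ
    (fun i => (z i).swap) hz
  rw [kernelDet_emKernel_swap] at h1
  rw [← h1]
  congr 1; ext s
  rw [← kernelDet_emKernel_swap]
  congr 1; ext i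
  rcases i with i | i <;> rfl

/-! ### The eigenvalue density as a determinant -/

theorem det_fromBlocks_zero₂₂ {R m : Type*} [CommRing R] [Fintype m] [DecidableEq m]
    (A B C : Matrix m m R) :
    (Matrix.fromBlocks A B (-C) 0).det = B.det * C.det := by
  -- The product of three shears is the rotation `[[0, -1], [1, 0]]`, which has determinant one.
  have h1 : Matrix.fromBlocks A B (-C) 0 = Matrix.fromBlocks (-B) A 0 (-C) *
      (Matrix.fromBlocks 1 (-1) 0 1 * Matrix.fromBlocks 1 0 1 1 *
        Matrix.fromBlocks 1 (-1) 0 1) := by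
    simp [Matrix.fromBlocks_multiply]
  rw [h1]
  simp only [Matrix.det_mul, Matrix.det_fromBlocks_zero₂₁, Matrix.det_fromBlocks_zero₁₂,
    Matrix.det_one, mul_one, Matrix.det_neg]
  rw [mul_mul_mul_comm, ← mul_pow]
  simp

theorem det_eval_eq_vdm {p : ℕ → ℝ[X]} (hm : ∀ i, (p i).Monic) (hd : ∀ i, (p i).natDegree = i)
    {n : ℕ} (l : Fin n → ℝ) :
    (Matrix.of fun i j : Fin n => (p j).eval (l i)).det = vdm l := by
  rw [vdm, ← Matrix.det_vandermonde]
  exact (Matrix.det_eval_matrixOfPolynomials_eq_det_vandermonde l (fun j => p j)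
    (fun j => hd j) fun j => hm j).symm

theorem det_weight {n : ℕ} (l m : Fin n → ℝ) :
    (Matrix.of fun i j : Fin n => weight V W τ (l j) (m i)).det =
      (∏ i, Real.exp (-V.eval (l i)) * Real.exp (-W.eval (m i))) *
        (Matrix.of fun i j : Fin n => Real.exp (τ * l i * m j)).det := by
  rw [← Matrix.det_transpose, Finset.prod_mul_distrib]
  have h1 : (Matrix.of fun i j : Fin n => weight V W τ (l j) (m i)).transpose =
      Matrix.of fun i j => Real.exp (-V.eval (l i)) *
        (Matrix.of fun i j => Real.exp (-W.eval (m j)) *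
          (Matrix.of fun i j : Fin n => Real.exp (τ * l i * m j)) i j) i j := by
    ext i j
    simp only [Matrix.transpose_apply, Matrix.of_apply, weight]
    rw [← Real.exp_add, ← Real.exp_add]
    congr 1; ring
  rw [h1, Matrix.det_mul_column, Matrix.det_mul_row]
  ring

/-- At `n + n` points the kernel matrix factors through the `n` biorthogonal functions, and its
determinant is the product of two Vandermonde determinants and the determinant of the weight,
divided by `∏ h_i²`. -/
theorem eigDensity_eq_kernelDet (hpq : IsBiorthogonal V W τ p q)
    (hh : ∀ i, hSq V W τ p q i ≠ 0) {n : ℕ} (l m : Fin n → ℝ) :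
    eigDensity V W τ l m = (∏ i ∈ Finset.range n, hSq V W τ p q i) *
      kernelDet (emKernel V W τ p q n) (Sum.elim (Sum.inl ∘ l) (Sum.inr ∘ m)) := by
  set A : Matrix (Fin n) (Fin n) ℝ := Matrix.of fun i j => (p j).eval (l i) with hA
  set P : Matrix (Fin n) (Fin n) ℝ := Matrix.of fun i j => transP V W τ p j (m i)
  set Q : Matrix (Fin n) (Fin n) ℝ := Matrix.of fun i j => transQ V W τ q j (l i)
  set Y : Matrix (Fin n) (Fin n) ℝ := Matrix.of fun i j => (q j).eval (m i) with hY
  set w : Matrix (Fin n) (Fin n) ℝ := Matrix.of fun i j => weight V W τ (l j) (m i) with hw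
  set D : Matrix (Fin n) (Fin n) ℝ := Matrix.diagonal fun i => 1 / hSq V W τ p q i with hD
  have h1 : (Matrix.of fun i j => emKernel V W τ p q n ((Sum.elim (Sum.inl ∘ l) (Sum.inr ∘ m)) i)
        ((Sum.elim (Sum.inl ∘ l) (Sum.inr ∘ m)) j)) =
      Matrix.fromBlocks A 0 P 1 *
        Matrix.fromBlocks (D * Q.transpose) (D * Y.transpose) (-w) 0 := by
    rw [Matrix.fromBlocks_multiply]
    ext i j
    rcases i with i | i <;> rcases j with j | j <;>
      simp only [Matrix.of_apply, Sum.elim_inl, Sum.elim_inr, Function.comp_apply, emKernel,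
        leftFun, rightFun, jump, sub_zero, zero_mul, add_zero, Matrix.one_mul, mul_zero,
        Matrix.fromBlocks_apply₁₁, Matrix.fromBlocks_apply₁₂, Matrix.fromBlocks_apply₂₁,
        Matrix.fromBlocks_apply₂₂, Matrix.add_apply, Matrix.neg_apply] <;>
      rw [Matrix.mul_apply, Finset.sum_range] <;>
      simp only [hD, Matrix.diagonal_mul, Matrix.transpose_apply, hw, Matrix.of_apply,
        ← sub_eq_add_neg, A, P, Q, Y]
    · exact Finset.sum_congr rfl fun k _ => by ring
    · exact Finset.sum_congr rfl fun k _ => by ring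
    · congr 1
      exact Finset.sum_congr rfl fun k _ => by ring
    · exact Finset.sum_congr rfl fun k _ => by ring
  rw [kernelDet, h1, Matrix.det_mul, Matrix.det_fromBlocks_zero₁₂, det_fromBlocks_zero₂₂,
    Matrix.det_mul, Matrix.det_transpose, hA, hY, hw, hD, Matrix.det_diagonal, Matrix.det_one,
    det_eval_eq_vdm hpq.monic_left hpq.natDegree_left,
    det_eval_eq_vdm hpq.monic_right hpq.natDegree_right, det_weight, eigDensity,
    Finset.prod_range]
  have hprod : (∏ i : Fin n, hSq V W τ p q i) * ∏ i : Fin n, 1 / hSq V W τ p q i = 1 := by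
    rw [← Finset.prod_mul_distrib]
    exact Finset.prod_eq_one fun i _ => mul_one_div_cancel (hh i)
  linear_combination (-(∏ i, Real.exp (-V.eval (l i)) * Real.exp (-W.eval (m i))) * vdm l * vdm m *
    (Matrix.of fun i j : Fin n => Real.exp (τ * l i * m j)).det) * hprod

/-! ### Correlation functions -/

/-- `fill` is concatenation, under the identification of `Fin I ⊕ Fin (n - I)` with `Fin n`. -/
theorem fill_finSumFinEquiv {I n : ℕ} (hI : I ≤ n) (x : Fin I → ℝ) (t : Fin (n - I) → ℝ)
    (k : Fin I ⊕ Fin (n - I)) :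
    (fill x t : Fin n → ℝ)
      (finSumFinEquiv.trans (finCongr (Nat.add_sub_of_le hI)) k) = Sum.elim x t k := by
  rcases k with k | k <;> simp [fill]

theorem eigDensity_fill (hpq : IsBiorthogonal V W τ p q)
    (hh : ∀ i, hSq V W τ p q i ≠ 0) {n I J : ℕ} (hI : I ≤ n) (hJ : J ≤ n)
    (l : Fin I → ℝ) (m : Fin J → ℝ) (s : Fin (n - I) → ℝ) (t : Fin (n - J) → ℝ) :
    eigDensity V W τ (fill l s : Fin n → ℝ) (fill m t) =
      (∏ i ∈ Finset.range n, hSq V W τ p q i) *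
      kernelDet (emKernel V W τ p q n) (Sum.elim (Sum.elim
        (Sum.elim (Sum.inl ∘ l) (Sum.inr ∘ m)) (Sum.inl ∘ s)) (Sum.inr ∘ t)) := by
  rw [eigDensity_eq_kernelDet hpq hh]
  congr 1
  rw [← kernelDet_comp_equiv _ ((Equiv.sumAssoc _ _ _).trans
    ((Equiv.sumSumSumComm (Fin I) (Fin J) (Fin (n - I)) (Fin (n - J))).trans
      (Equiv.sumCongr (finSumFinEquiv.trans (finCongr (Nat.add_sub_of_le hI)))
        (finSumFinEquiv.trans (finCongr (Nat.add_sub_of_le hJ))))))]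
  congr 1
  ext k
  have h1 := fill_finSumFinEquiv hI l s
  have h2 := fill_finSumFinEquiv hJ m t
  rcases k with ((k | k) | k) | k
  · exact congrArg Sum.inl (h1 (.inl k))
  · exact congrArg Sum.inr (h2 (.inl k))
  · exact congrArg Sum.inl (h1 (.inr k))
  · exact congrArg Sum.inr (h2 (.inr k))

theorem integrable_eigDensity_fill (h : GaussianBound V W τ ε B) (hε : 0 < ε)
    (hpq : IsBiorthogonal V W τ p q) (hh : ∀ i, hSq V W τ p q i ≠ 0) {n I J : ℕ} (hI : I ≤ n)
    (hJ : J ≤ n) (l : Fin I → ℝ) (m : Fin J → ℝ) :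
    Integrable fun z : (Fin (n - I) → ℝ) × (Fin (n - J) → ℝ) =>
      eigDensity V W τ (fill l z.1 : Fin n → ℝ) (fill m z.2) := by
  obtain ⟨α, β, hab, hi, hi'⟩ := exists_abs_emKernel_le (p := p) (q := q) h hε n
  simp only [eigDensity_fill hpq hh hI hJ]
  exact (integrable_kernelDet_prod (measurable_emKernel h hε n) hab measurable_inl hi
    measurable_inr hi' _ _ _).const_mul _

theorem integral_eigDensity_fill (h : GaussianBound V W τ ε B) (hε : 0 < ε)
    (hpq : IsBiorthogonal V W τ p q) (hh : ∀ i, hSq V W τ p q i ≠ 0) {n I J : ℕ} (hI : I ≤ n)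
    (hJ : J ≤ n) (l : Fin I → ℝ) (m : Fin J → ℝ) :
    ∫ z : (Fin (n - I) → ℝ) × (Fin (n - J) → ℝ),
      eigDensity V W τ (fill l z.1 : Fin n → ℝ) (fill m z.2) =
    (∏ i ∈ Finset.range n, hSq V W τ p q i) * ((n - I).factorial * ((n - J).factorial *
      (kernelMatrix V W τ p q n l m).det)) := by
  have hi := integrable_eigDensity_fill h hε hpq hh hI hJ l m
  rw [Measure.volume_eq_prod] at hi ⊢
  rw [integral_prod _ hi]
  simp only [eigDensity_fill hpq hh hI hJ, integral_const_mul]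
  congr 1
  have h1 : ∀ s : Fin (n - I) → ℝ, ∫ t : Fin (n - J) → ℝ, kernelDet (emKernel V W τ p q n)
      (Sum.elim (Sum.elim (Sum.elim (Sum.inl ∘ l) (Sum.inr ∘ m)) (Sum.inl ∘ s)) (Sum.inr ∘ t)) =
      (n - J).factorial * kernelDet (emKernel V W τ p q n)
        (Sum.elim (Sum.elim (Sum.inl ∘ l) (Sum.inr ∘ m)) (Sum.inl ∘ s)) := fun s =>
    integral_kernelDet_inr h hε hpq hh hJ _ (by simp [isFirst])
  simp only [h1, integral_const_mul]
  rw [integral_kernelDet_inl h hε hpq hh hI _ (by simp [isFirst]), det_kernelMatrix]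
  ring

theorem fill_of_isEmpty {n : ℕ} (x : Fin 0 → ℝ) (t : Fin (n - 0) → ℝ) :
    (fill x t : Fin n → ℝ) = t := by
  ext k
  simp [fill]

theorem eigPartition_eq (h : GaussianBound V W τ ε B) (hε : 0 < ε)
    (hpq : IsBiorthogonal V W τ p q) (hh : ∀ i, hSq V W τ p q i ≠ 0) (n : ℕ) :
    eigPartition V W τ n =
      (∏ i ∈ Finset.range n, hSq V W τ p q i) * (n.factorial * n.factorial) := by
  have h1 := integral_eigDensity_fill h hε hpq hh (Nat.zero_le n) (Nat.zero_le n)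
    (fun i => i.elim0) (fun i => i.elim0)
  simp only [fill_of_isEmpty, Matrix.det_isEmpty, mul_one] at h1
  exact h1

theorem integrable_eigDensity (h : GaussianBound V W τ ε B) (hε : 0 < ε)
    (hpq : IsBiorthogonal V W τ p q) (hh : ∀ i, hSq V W τ p q i ≠ 0) (n : ℕ) :
    Integrable fun z : (Fin n → ℝ) × (Fin n → ℝ) => eigDensity V W τ z.1 z.2 := by
  have h1 := integrable_eigDensity_fill h hε hpq hh (Nat.zero_le n) (Nat.zero_le n)
    (fun i => i.elim0) (fun i => i.elim0)
  simp only [fill_of_isEmpty] at h1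
  exact h1

end

end TwoMatrix

theorem mainTheorem6 (n : ℕ) (hn : 1 ≤ n) (V W : ℝ[X])
    (hVdeg : Even V.natDegree) (hVlead : 0 < V.leadingCoeff)
    (hWdeg : Even W.natDegree) (hWlead : 0 < W.leadingCoeff)
    (τ : ℝ) (hτ : τ ≠ 0)
    (hZ : Integrable (fun M : TwoMatrix.HermCoord n × TwoMatrix.HermCoord n =>
      TwoMatrix.matrixDensity V W τ M.1 M.2)) :
    (∃! pq : (ℕ → ℝ[X]) × (ℕ → ℝ[X]), TwoMatrix.IsBiorthogonal V W τ pq.1 pq.2) ∧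
    Integrable (fun z : (Fin n → ℝ) × (Fin n → ℝ) => TwoMatrix.eigDensity V W τ z.1 z.2) ∧
    TwoMatrix.eigPartition V W τ n ≠ 0 ∧
    ∀ p q : ℕ → ℝ[X], TwoMatrix.IsBiorthogonal V W τ p q →
      (∀ i, TwoMatrix.hSq V W τ p q i ≠ 0) ∧
      ∀ (I J : ℕ), I ≤ n → J ≤ n → ∀ (l : Fin I → ℝ) (m : Fin J → ℝ),
        Integrable (fun z : (Fin (n - I) → ℝ) × (Fin (n - J) → ℝ) =>
          TwoMatrix.eigDensity V W τ (TwoMatrix.fill l z.1 : Fin n → ℝ)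
            (TwoMatrix.fill m z.2)) ∧
        TwoMatrix.corr V W τ n l m = (TwoMatrix.kernelMatrix V W τ p q n l m).det := by
  obtain ⟨ε, hε, B, h⟩ := TwoMatrix.exists_gaussianBound hn hVdeg hVlead hWdeg hWlead hτ hZ
  have hex := h.existsUnique_isBiorthogonal hε hτ
  obtain ⟨⟨p₀, q₀⟩, hpq₀, -⟩ := hex
  have hh₀ := hpq₀.hSq_ne_zero h hε hτ
  have hfac : ∀ k : ℕ, (k.factorial : ℝ) ≠ 0 := fun k => by
    exact_mod_cast k.factorial_ne_zero
  refine ⟨h.existsUnique_isBiorthogonal hε hτ,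
    TwoMatrix.integrable_eigDensity h hε hpq₀ hh₀ n, ?_, fun p q hpq => ?_⟩
  · rw [TwoMatrix.eigPartition_eq h hε hpq₀ hh₀]
    exact mul_ne_zero (Finset.prod_ne_zero_iff.2 fun i _ => hh₀ i)
      (mul_ne_zero (hfac n) (hfac n))
  · have hh := hpq.hSq_ne_zero h hε hτ
    refine ⟨hh, fun I J hI hJ l m =>
      ⟨TwoMatrix.integrable_eigDensity_fill h hε hpq hh hI hJ l m, ?_⟩⟩
    have hprod : ∏ i ∈ Finset.range n, TwoMatrix.hSq V W τ p q i ≠ 0 :=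
      Finset.prod_ne_zero_iff.2 fun i _ => hh i
    rw [TwoMatrix.corr, TwoMatrix.integral_eigDensity_fill h hε hpq hh hI hJ,
      TwoMatrix.eigPartition_eq h hε hpq hh]
    have h1 := hfac n
    have h2 := hfac (n - I)
    have h3 := hfac (n - J)
    field_simp
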